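/- Let $(\Omega,\Sigma,\mu)$ be a finite measure space and $1\le p<\infty$. Let $Y=Y(\mu)$ be a Banach function space over $\mu$: a linear subspace of the space $L^0(\mu)$ of ($\mu$-a.e. classes of) real measurable functions, complete under a norm, containing all simple functions, and such that $|f|\le|g|$ with $g\in Y$ implies $f\in Y$ and $\|f\|_Y\le\|g\|_Y$. Assume that $Y$ is $p$-convex, i.e. there is $K>0$ with $\big\|(\sum_{i=1}^n|f_i|^p)^{1/p}\big\|_Y\le K\big(\sum_{i=1}^n\|f_i\|_Y^p\big)^{1/p}$ for all finite families $f_1,\dots,f_n\in Y$, and order continuous, i.e. $f_n\downarrow0$ in $Y$ implies $\|f_n\|_Y\to0$. Put $Y_{[p]}=\{f\in L^0(\mu):|f|^{1/p}\in Y\}$, $\|f\|_{Y_{[p]}}=\||f|^{1/p}\|_Y^p$, and let $(Y_{[p]})'$ be its Köthe dual, the space of all $g\in L^0(\mu)$ with $fg\in L^1(\mu)$ for every $f\in Y_{[p]}$, with norm $\|g\|=\sup\{\int fg\,d\mu:\|f\|_{Y_{[p]}}\le1\}$ and closed unit ball $B_{(Y_{[p]})'}$. Let $E$ be a real Banach space,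 $B_{E^*}$ the closed unit ball of its dual with the weak* topology, and $T:E\to Y$ a bounded linear operator. For $0\le y^*\in B_{(Y_{[p]})'}$ let $i:Y\to L^p(y^*d\mu)$ be the canonical map $f\mapsto f$. The following are equivalent. (i) $T$ is lattice $p$-summing: there is $C>0$ such that for all finite families $x_1,\dots,x_n\in E$, with $1/p+1/p'=1$, $$\Big\|\Big(\sum_{i=1}^n|T(x_i)|^p\Big)^{1/p}\Big\|_Y\le C\sup_{(a_i)\in B_{\ell^{p'}}}\Big\|\sum_{i=1}^na_ix_i\Big\|_E .$$ (ii) There is $C>0$ such that for each $0\le y^*\in B_{(Y_{[p]})'}$ there is a Borel probability measure $\eta$ on $B_{E^*}$ such that for every $x\in E$ $$\Big(\int_\Omega|T(x)|^p\,y^*\,d\mu\Big)^{1/p}\le C\Big(\int_{B_{E^*}}|\langle x,x^*\rangle|^p\,d\eta(x^*)\Big)^{1/p}.$$ (iii) For each $0\le y^*\in B_{(Y_{[p]})'}$ there are a Borel probability measure $\eta$ on $B_{E^*}$, a linear subspace $S$ of $L^p(\eta)$ containing the class of $\langle x,\cdot\rangle$ for every $x\in E$, and a bounded linear operator $\tilde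 T:S\to L^p(y^*d\mu)$ with $i(T(x))=\tilde T(\langle x,\cdot\rangle)$ for all $x\in E$ (so $i\circ T$ factors as $E\to S\to L^p(y^*d\mu)$, where the first map sends $x$ to the continuous function $\langle x,\cdot\rangle\in C(B_{E^*})$ and then to its class in $S$); moreover there is a constant $C<\infty$, independent of $y^*$, such that $i\circ T$ is $p$-summing with $p$-summing norm at most $C$, i.e. $\big(\sum_{i=1}^n\|i(T(x_i))\|^p\big)^{1/p}\le C\sup_{x^*\in B_{E^*}}\big(\sum_{i=1}^n|\langle x_i,x^*\rangle|^p\big)^{1/p}$ for all finite families in $E$. -/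

import Mathlib

open MeasureTheory Filter Topology
open scoped ENNReal NNReal

noncomputable section

/-- The class of `ω ↦ |f ω| ^ r` in `L⁰(μ)`. -/
def absRpow {Ω : Type*} [MeasurableSpace Ω] {μ : Measure Ω} (r : ℝ) (f : Ω →ₘ[μ] ℝ) :
    Ω →ₘ[μ] ℝ :=
  AEEqFun.compMeasurable (fun t : ℝ => |t| ^ r) (by fun_prop) f

/-- The function `(∑ i, |f i| ^ r) ^ (1 / r)` in `L⁰(μ)`. -/
def lattSum {Ω : Type*} [MeasurableSpace Ω] {μ : Measure Ω} (r : ℝ) {n : ℕ}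
    (f : Fin n → Ω →ₘ[μ] ℝ) : Ω →ₘ[μ] ℝ :=
  absRpow (1 / r) (∑ i, absRpow r (f i))

/-- A Banach function space over `μ`: a linear subspace of `L⁰(μ)` (real measurable functions
modulo `μ`-a.e. equality) with a complete norm, which contains the simple functions and is an ideal
with monotone norm. -/
structure BanachFunctionSpace {Ω : Type*} [MeasurableSpace Ω] (μ : Measure Ω) where
  carrier : Submodule ℝ (Ω →ₘ[μ] ℝ)
  nrm : carrier → ℝ
  nrm_add_le : ∀ f g, nrm (f + g) ≤ nrm f + nrm g
  nrm_smul : ∀ (c : ℝ) f, nrm (c • f) = |c| * nrm f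
  eq_zero_of_nrm : ∀ f, nrm f = 0 → f = 0
  complete : ∀ u : ℕ → carrier,
    (∀ ε > 0, ∃ N, ∀ m ≥ N, ∀ n ≥ N, nrm (u m - u n) < ε) →
      ∃ f, Tendsto (fun n => nrm (u n - f)) atTop (𝓝 0)
  simple_mem : ∀ s : SimpleFunc Ω ℝ, AEEqFun.mk s s.aestronglyMeasurable ∈ carrier
  solid : ∀ (f : Ω →ₘ[μ] ℝ) (g : carrier), |f| ≤ |(g : Ω →ₘ[μ] ℝ)| →
    ∃ hf : f ∈ carrier, nrm ⟨f, hf⟩ ≤ nrm g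

namespace BanachFunctionSpace

variable {Ω : Type*} [MeasurableSpace Ω] {μ : Measure Ω}

instance instNormedAddCommGroup (Y : BanachFunctionSpace μ) : NormedAddCommGroup Y.carrier :=
  AddGroupNorm.toNormedAddCommGroup
    { toFun := Y.nrm
      map_zero' := by simpa using Y.nrm_smul 0 0
      add_le' := Y.nrm_add_le
      neg' := fun f => by rw [← neg_one_smul ℝ f, Y.nrm_smul]; simp
      eq_zero_of_map_eq_zero' := Y.eq_zero_of_nrm }

theorem norm_eq (Y : BanachFunctionSpace μ) (f : Y.carrier) : ‖f‖ = Y.nrm f := rfl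

instance instNormedSpace (Y : BanachFunctionSpace μ) : NormedSpace ℝ Y.carrier where
  norm_smul_le c f := (Y.nrm_smul c f).le

open Classical in
/-- The norm of `Y`, extended to all of `L⁰(μ)` by `∞` off `Y`. -/
def extNorm (Y : BanachFunctionSpace μ) (f : Ω →ₘ[μ] ℝ) : ℝ≥0∞ :=
  if hf : f ∈ Y.carrier then ENNReal.ofReal ‖(⟨f, hf⟩ : Y.carrier)‖ else ∞

/-- `‖f n‖ → 0` for every sequence in `Y` that decreases to `0` (`μ`-a.e.). -/
def OrderContinuous (Y : BanachFunctionSpace μ) : Prop :=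
  ∀ u : ℕ → Y.carrier, Antitone (fun n => (u n : Ω →ₘ[μ] ℝ)) →
    (∀ᵐ ω ∂μ, Tendsto (fun n => (u n : Ω →ₘ[μ] ℝ) ω) atTop (𝓝 0)) →
      Tendsto (fun n => ‖u n‖) atTop (𝓝 0)

/-- `‖(∑ |f i| ^ r) ^ (1 / r)‖ ≤ K (∑ ‖f i‖ ^ r) ^ (1 / r)` for some `K` and all finite families
in `Y`. -/
def PConvex (Y : BanachFunctionSpace μ) (r : ℝ) : Prop :=
  ∃ K : ℝ, 0 < K ∧ ∀ (n : ℕ) (f : Fin n → Y.carrier),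
    Y.extNorm (lattSum r fun i => (f i : Ω →ₘ[μ] ℝ)) ≤
      ENNReal.ofReal (K * (∑ i, ‖f i‖ ^ r) ^ (1 / r))

/-- The quasi-norm `‖|f| ^ (1 / r)‖ ^ r` of the `r`-th power of `Y`, extended by `∞`; the `r`-th
power itself is the set where it is finite. -/
def powNorm (Y : BanachFunctionSpace μ) (r : ℝ) (f : Ω →ₘ[μ] ℝ) : ℝ≥0∞ :=
  Y.extNorm (absRpow (1 / r) f) ^ r

/-- The Köthe dual of the `r`-th power of `Y`: all `g` with `f g ∈ L¹(μ)` for every `f` in the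
`r`-th power. -/
def powKothe (Y : BanachFunctionSpace μ) (r : ℝ) : Set (Ω →ₘ[μ] ℝ) :=
  {g | ∀ f : Ω →ₘ[μ] ℝ, Y.powNorm r f < ∞ → Integrable (fun ω => f ω * g ω) μ}

/-- The norm `sup {∫ f g dμ : ‖f‖ ≤ 1}` of the Köthe dual of the `r`-th power of `Y`. -/
def powKotheNorm (Y : BanachFunctionSpace μ) (r : ℝ) (g : Ω →ₘ[μ] ℝ) : ℝ≥0∞ :=
  ⨆ (f : Ω →ₘ[μ] ℝ) (_ : Y.powNorm r f ≤ 1), ENNReal.ofReal (∫ ω, f ω * g ω ∂μ)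

/-- The nonnegative elements of the closed unit ball of the Köthe dual of the `r`-th power. -/
def posBall (Y : BanachFunctionSpace μ) (r : ℝ) : Set (Ω →ₘ[μ] ℝ) :=
  {g | g ∈ Y.powKothe r ∧ Y.powKotheNorm r g ≤ 1 ∧ 0 ≤ g}

end BanachFunctionSpace

/-- The measure `y dμ`, for a nonnegative `y`. -/
def weighted {Ω : Type*} [MeasurableSpace Ω] (μ : Measure Ω) (y : Ω →ₘ[μ] ℝ) : Measure Ω :=
  μ.withDensity fun ω => ENNReal.ofReal (y ω)

namespace BanachFunctionSpace

variable {Ω : Type*} [MeasurableSpace Ω] {μ : Measure Ω}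

theorem powNorm_absRpow_lt_top (Y : BanachFunctionSpace μ) {r : ℝ} (hr : 0 < r)
    (f : Y.carrier) : Y.powNorm r (absRpow r (f : Ω →ₘ[μ] ℝ)) < ∞ := by
  have key : |absRpow (1 / r) (absRpow r (f : Ω →ₘ[μ] ℝ))| ≤ |(f : Ω →ₘ[μ] ℝ)| := by
    rw [← AEEqFun.coeFn_le]
    filter_upwards [AEEqFun.coeFn_abs (absRpow (1 / r) (absRpow r (f : Ω →ₘ[μ] ℝ))),
      AEEqFun.coeFn_abs (f : Ω →ₘ[μ] ℝ),
      AEEqFun.coeFn_compMeasurable (fun t : ℝ => |t| ^ (1 / r)) (by fun_prop)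
        (absRpow r (f : Ω →ₘ[μ] ℝ)),
      AEEqFun.coeFn_compMeasurable (fun t : ℝ => |t| ^ r) (by fun_prop)
        (f : Ω →ₘ[μ] ℝ)] with ω h1 h2 h3 h4
    rw [h1, h2]
    change absRpow (1 / r) (absRpow r (f : Ω →ₘ[μ] ℝ)) ω = _ at h3
    change absRpow r (f : Ω →ₘ[μ] ℝ) ω = _ at h4
    rw [h3]
    simp only [Function.comp_apply]
    rw [h4]
    simp only [Function.comp_apply]
    rw [abs_of_nonneg (Real.rpow_nonneg (abs_nonneg _) r), ← Real.rpow_mul (abs_nonneg _),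
      mul_one_div_cancel hr.ne', Real.rpow_one, abs_abs]
  obtain ⟨hm, -⟩ := Y.solid _ f key
  unfold powNorm extNorm
  rw [dif_pos hm]
  exact ENNReal.rpow_lt_top_of_nonneg hr.le ENNReal.ofReal_ne_top

theorem memLp_weighted (Y : BanachFunctionSpace μ) {p : ℝ≥0∞} [hp1 : Fact (1 ≤ p)] (hp : p ≠ ∞)
    {y : Ω →ₘ[μ] ℝ} (hy : y ∈ Y.powKothe p.toReal) (f : Y.carrier) :
    MemLp (f : Ω →ₘ[μ] ℝ) p (weighted μ y) := by
  have hp0 : p ≠ 0 := (lt_of_lt_of_le one_pos hp1.out).ne'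
  have hr : 0 < p.toReal := ENNReal.toReal_pos hp0 hp
  refine ⟨(AEEqFun.aestronglyMeasurable _).mono_ac (withDensity_absolutelyContinuous _ _), ?_⟩
  rw [eLpNorm_lt_top_iff_lintegral_rpow_enorm_lt_top hp0 hp, weighted,
    lintegral_withDensity_eq_lintegral_mul₀
      (AEEqFun.aestronglyMeasurable y).aemeasurable.ennreal_ofReal
      ((AEEqFun.aestronglyMeasurable (f : Ω →ₘ[μ] ℝ)).enorm.pow_const _)]
  refine lt_of_le_of_lt ?_ (hy _ (Y.powNorm_absRpow_lt_top hr f)).2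
  refine lintegral_mono_ae ?_
  filter_upwards [AEEqFun.coeFn_compMeasurable (fun t : ℝ => |t| ^ p.toReal) (by fun_prop)
        (f : Ω →ₘ[μ] ℝ)] with ω h
  change absRpow p.toReal (f : Ω →ₘ[μ] ℝ) ω = _ at h
  rw [h]
  simp only [Function.comp_apply, Pi.mul_apply]
  rw [enorm_mul, mul_comm, Real.enorm_rpow_of_nonneg (abs_nonneg _) hr.le, Real.enorm_abs]
  gcongr
  exact Real.ofReal_le_enorm _

/-- The canonical map `i : Y(μ) → L^p(y dμ)`, `f ↦ f`, for `0 ≤ y` in the Köthe dual of the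
`p`-th power of `Y`. -/
def inclusion (Y : BanachFunctionSpace μ) {p : ℝ≥0∞} [Fact (1 ≤ p)] (hp : p ≠ ∞)
    {y : Ω →ₘ[μ] ℝ} (hy : y ∈ Y.powKothe p.toReal) :
    Y.carrier →ₗ[ℝ] Lp ℝ p (weighted μ y) where
  toFun f := (Y.memLp_weighted hp hy f).toLp _
  map_add' f g := by
    rw [← MemLp.toLp_add]
    exact MemLp.toLp_congr _ _
      ((withDensity_absolutelyContinuous _ _).ae_le (AEEqFun.coeFn_add _ _))
  map_smul' c f := by
    rw [RingHom.id_apply, ← MemLp.toLp_const_smul]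
    exact MemLp.toLp_congr _ _
      ((withDensity_absolutelyContinuous _ _).ae_le (AEEqFun.coeFn_smul _ _))

/-- `T` is lattice `p`-summing: there is `C > 0` with
`‖(∑ |T xᵢ| ^ p) ^ (1 / p)‖ ≤ C sup {‖∑ aᵢ xᵢ‖ : (aᵢ) in the unit ball of ℓ^{p'}}` for all finite
families, where `1 / p + 1 / p' = 1`. -/
def IsLatticeSumming {E : Type*} [NormedAddCommGroup E] [NormedSpace ℝ E]
    (Y : BanachFunctionSpace μ) (p : ℝ≥0∞) (T : E →L[ℝ] Y.carrier) : Prop :=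
  ∃ C : ℝ≥0, 0 < C ∧ ∀ (n : ℕ) (x : Fin n → E),
    Y.extNorm (lattSum p.toReal fun i => (T (x i) : Ω →ₘ[μ] ℝ)) ≤
      C * ⨆ (a : PiLp p.conjExponent fun _ : Fin n => ℝ) (_ : ‖a‖ ≤ 1), ‖∑ i, a i • x i‖ₑ

end BanachFunctionSpace

/-- The closed unit ball of the dual of `E`, with the weak* topology and its Borel sets. -/
def DualBall (E : Type*) [NormedAddCommGroup E] [NormedSpace ℝ E] : Type _ :=
  {φ : WeakDual ℝ E // ‖WeakDual.toStrongDual φ‖ ≤ 1}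

namespace DualBall

variable {E : Type*} [NormedAddCommGroup E] [NormedSpace ℝ E]

instance instTopologicalSpace : TopologicalSpace (DualBall E) :=
  inferInstanceAs (TopologicalSpace {φ : WeakDual ℝ E // ‖WeakDual.toStrongDual φ‖ ≤ 1})

instance instMeasurableSpace : MeasurableSpace (DualBall E) := borel _

instance instBorelSpace : BorelSpace (DualBall E) := ⟨rfl⟩

instance instCompactSpace : CompactSpace (DualBall E) := by
  have h := WeakDual.isCompact_closedBall (0 : StrongDual ℝ E) 1
  have h2 : (WeakDual.toStrongDual ⁻¹' Metric.closedBall (0 : StrongDual ℝ E) 1)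
      = {φ : WeakDual ℝ E | ‖WeakDual.toStrongDual φ‖ ≤ 1} := by
    ext φ
    simp
  rw [h2] at h
  exact isCompact_iff_compactSpace.mp h

/-- The canonical map `E → C(B_{E*})`, `x ↦ ⟨x, ·⟩`. -/
def eval : E →ₗ[ℝ] C(DualBall E, ℝ) where
  toFun x := ⟨fun φ => φ.1 x, (WeakDual.eval_continuous x).comp continuous_subtype_val⟩
  map_add' x y := by ext φ; exact map_add φ.1 x y
  map_smul' c x := by ext φ; exact map_smul φ.1 c x

end DualBall

/-- The `p`-summing norm of a linear map `R`: the infimum of all constants `K` with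
`(∑ ‖R xᵢ‖ ^ p) ^ (1 / p) ≤ K sup {(∑ |⟨xᵢ, φ⟩| ^ p) ^ (1 / p) : φ in the dual unit ball}` for all
finite families; it is `∞` if there is none, that is, if `R` is not `p`-summing. -/
def pSummingNorm {E F : Type*} [NormedAddCommGroup E] [NormedSpace ℝ E] [NormedAddCommGroup F]
    [NormedSpace ℝ F] (r : ℝ) (R : E →ₗ[ℝ] F) : ℝ≥0∞ :=
  ⨅ (K : ℝ≥0) (_ : ∀ (n : ℕ) (x : Fin n → E), (∑ i, ‖R (x i)‖ₑ ^ r) ^ (1 / r) ≤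
      K * ⨆ φ : DualBall E, (∑ i, ‖DualBall.eval (x i) φ‖ₑ ^ r) ^ (1 / r)), (K : ℝ≥0∞)

/-- `R : E → F` factors as `E → C(B_{E*}) → S → F`, where the first map is `x ↦ ⟨x, ·⟩`, `S` is a
linear subspace of `L^p(η)` containing the classes of all `⟨x, ·⟩`, the second map takes `⟨x, ·⟩`
to its class in `S`, and the third is a bounded linear operator. -/
def FactorsThroughSubspace {E F : Type*} [NormedAddCommGroup E] [NormedSpace ℝ E]
    [NormedAddCommGroup F] [NormedSpace ℝ F] (p : ℝ≥0∞) [Fact (1 ≤ p)] (R : E →ₗ[ℝ] F)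
    (η : ProbabilityMeasure (DualBall E)) : Prop :=
  ∃ (S : Submodule ℝ (Lp ℝ p (η : Measure (DualBall E))))
    (hS : ∀ x : E, ContinuousMap.toLp p (η : Measure (DualBall E)) ℝ (DualBall.eval x) ∈ S)
    (T' : S →L[ℝ] F),
    ∀ x : E, T' ⟨ContinuousMap.toLp p (η : Measure (DualBall E)) ℝ (DualBall.eval x), hS x⟩ = R x

end

/-! The link between the three conditions is a pointwise identity. If `g` is the lattice sum of the
`T xᵢ`, then `∑ ‖i (T xᵢ)‖ ^ p = ∫ |g| ^ p y dμ` for every admissible `y`. Lattice summability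
bounds the norm of `g`, while (ii) and (iii) bound these integrals uniformly in `y`. The task is to
compare `‖g‖ ^ p` with the supremum of `∫ |g| ^ p y dμ` over the positive part of the Köthe ball.

One inequality is the definition of the Köthe norm. The other, with the factor `K ^ p`, is
`exists_mem_posBall_norming`. By `p`-convexity the quasi-norm of the `p`-th power is subadditive up
to `K ^ p`, so a Hahn–Banach argument yields a linear functional that it dominates and that is large
at `|g| ^ p` (`exists_dominated_functional`). Domination makes the functional positive, order
continuity makes it countably additive on sets, and Radon–Nikodym turns it into a density `y`.

Hence (i) says that the operators `i ∘ T` are `p`-summing with one common constant, once the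
supremum over the ball of `ℓ^{p'}` is rewritten as a supremum over the dual ball (Hölder and
Hahn–Banach). Pietsch domination, proved here by extending a functional from the constants to
`C(B_{E*})` and representing it by a measure, gives (ii) for each `y` with a constant that does not
depend on `y`. The factorization in (iii) is the induced map on the range of `E → L^p(η)`. -/

noncomputable section

/-! ### Extension of functionals, representing measures and Pietsch domination -/

/-- A form of the Riesz extension theorem: consistent homogeneous upper bounds are satisfied by a
linear functional. -/
theorem exists_linearMap_le_of_cone {V : Type*} [AddCommGroup V] [Module ℝ V]
    (s : PointedCone ℝ (V × ℝ)) (h0 : ∀ c : ℝ, ((0 : V), c) ∈ s → 0 ≤ c)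
    (hs : ∀ v : V, ∃ c : ℝ, (v, c) ∈ s) :
    ∃ L : V →ₗ[ℝ] ℝ, ∀ v c, (v, c) ∈ s → L v ≤ c := by
  -- On `{0} × ℝ` the functional `(0, c) ↦ c` is nonnegative on the cone by `h0`. A positive
  -- extension `g` satisfies `g (v, 0) + c ≥ 0` on `s`, so `v ↦ -g (v, 0)` meets all the bounds.
  let f : (V × ℝ) →ₗ.[ℝ] ℝ :=
    { domain := LinearMap.ker (LinearMap.fst ℝ V ℝ)
      toFun := LinearMap.snd ℝ V ℝ ∘ₗ Submodule.subtype _ }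
  have hf : ∀ x : f.domain, f x = (x : V × ℝ).2 := fun _ => rfl
  obtain ⟨g, hg, hgs⟩ := riesz_extension s f
    (by
      rintro ⟨⟨v, c⟩, hx⟩ hm
      obtain rfl : v = 0 := hx
      exact h0 c hm)
    (by
      rintro ⟨v, a⟩
      obtain ⟨c, hc⟩ := hs v
      exact ⟨⟨(0, c - a), rfl⟩, by simpa using hc⟩)
  refine ⟨-(g ∘ₗ LinearMap.inl ℝ V ℝ), fun v c hc => ?_⟩
  have h1 := hgs _ hc
  have h2 : g (0, c) = c := hg ⟨(0, c), rfl⟩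
  have h3 : g (v, c) = g (v, 0) + g (0, c) := by rw [← map_add]; simp
  simp only [LinearMap.neg_apply, LinearMap.comp_apply, LinearMap.inl_apply]
  linarith

/-- The Riesz representation theorem for linear functionals on `C(X)`, `X` compact, that are
positive and normalised. -/
theorem exists_probabilityMeasure_of_positive {X : Type*} [TopologicalSpace X] [CompactSpace X]
    [T2Space X] [MeasurableSpace X] [BorelSpace X] (L : C(X, ℝ) →ₗ[ℝ] ℝ)
    (hL : ∀ f, 0 ≤ f → 0 ≤ L f) (h1 : L 1 = 1) :
    ∃ η : ProbabilityMeasure X, ∀ f : C(X, ℝ), ∫ x, f x ∂(η : Measure X) = L f := by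
  let L' : CompactlySupportedContinuousMap X ℝ →ₚ[ℝ] ℝ := PositiveLinearMap.mk₀
    { toFun := fun f => L (CompactlySupportedContinuousMap.continuousMapEquiv.symm f)
      map_add' := fun f g => by rw [← map_add]; rfl
      map_smul' := fun c f => by rw [RingHom.id_apply, ← map_smul]; rfl }
    (fun f hf => hL _ hf)
  have key : ∀ f : C(X, ℝ), ∫ x, f x ∂(RealRMK.rieszMeasure L') = L f := fun f =>
    RealRMK.integral_rieszMeasure L' (CompactlySupportedContinuousMap.continuousMapEquiv f)
  have hone := key 1
  rw [h1] at hone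
  have hp : IsProbabilityMeasure (RealRMK.rieszMeasure L') := by
    refine ⟨?_⟩
    simp only [ContinuousMap.one_apply, integral_const, smul_eq_mul, mul_one] at hone
    rwa [measureReal_def, ENNReal.toReal_eq_one_iff] at hone
  exact ⟨⟨_, hp⟩, key⟩

instance DualBall.instT2Space {E : Type*} [NormedAddCommGroup E] [NormedSpace ℝ E] :
    T2Space (DualBall E) :=
  inferInstanceAs (T2Space {φ : WeakDual ℝ E // ‖WeakDual.toStrongDual φ‖ ≤ 1})

instance DualBall.instNonempty {E : Type*} [NormedAddCommGroup E] [NormedSpace ℝ E] :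
    Nonempty (DualBall E) := ⟨⟨0, by simp⟩⟩

theorem DualBall.abs_eval_le {E : Type*} [NormedAddCommGroup E] [NormedSpace ℝ E] (x : E)
    (φ : DualBall E) : |DualBall.eval x φ| ≤ ‖x‖ := by
  have h := (WeakDual.toStrongDual φ.1).le_opNorm x
  have h2 := mul_le_mul_of_nonneg_right φ.2 (norm_nonneg x)
  rw [one_mul] at h2
  exact h.trans h2

/-- The continuous function `φ ↦ |φ x| ^ r` on the dual unit ball. -/
def DualBall.evalPow {E : Type*} [NormedAddCommGroup E] [NormedSpace ℝ E] {r : ℝ} (hr : 0 < r)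
    (x : E) : C(DualBall E, ℝ) :=
  ⟨fun φ => |DualBall.eval x φ| ^ r,
    (DualBall.eval x).continuous.abs.rpow_const fun _ => Or.inr hr.le⟩

/-- **Pietsch domination theorem.** -/
theorem exists_pietsch_measure {E F : Type*} [NormedAddCommGroup E] [NormedSpace ℝ E]
    [NormedAddCommGroup F] [NormedSpace ℝ F] {r : ℝ} (hr : 0 < r) (R : E →ₗ[ℝ] F) {D : ℝ}
    (h : ∀ (n : ℕ) (x : Fin n → E) (M : ℝ),
      (∀ φ : DualBall E, ∑ i, |DualBall.eval (x i) φ| ^ r ≤ M) → ∑ i, ‖R (x i)‖ ^ r ≤ D * M)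
    (hD : 0 < D) :
    ∃ η : ProbabilityMeasure (DualBall E), ∀ x : E,
      ‖R x‖ ^ r ≤ D * ∫ φ, |DualBall.eval x φ| ^ r ∂(η : Measure (DualBall E)) := by
  -- Concatenating families makes this set of functions closed under sums. It is also closed
  -- upwards, and the empty family puts every nonnegative function in it, so a functional that is
  -- nonnegative on `s` is automatically positive.
  let s : PointedCone ℝ C(DualBall E, ℝ) :=
    { carrier := {f | ∃ (n : ℕ) (x : Fin n → E),
        ∀ φ, D * ∑ i, |DualBall.eval (x i) φ| ^ r - ∑ i, ‖R (x i)‖ ^ r ≤ f φ}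
      zero_mem' := ⟨0, Fin.elim0, by simp⟩
      add_mem' := by
        rintro f g ⟨n, x, hx⟩ ⟨m, y, hy⟩
        refine ⟨n + m, Fin.append x y, fun φ => ?_⟩
        simp only [Fin.sum_univ_add, Fin.append_left, Fin.append_right, ContinuousMap.add_apply]
        linarith [hx φ, hy φ]
      smul_mem' := by
        rintro ⟨c, hc⟩ f ⟨n, x, hx⟩
        refine ⟨n, fun i => (c ^ (1 / r)) • x i, fun φ => ?_⟩
        have e : ∀ t : ℝ, 0 ≤ t → (c ^ (1 / r) * t) ^ r = c * t ^ r := fun t ht => by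
          rw [Real.mul_rpow (Real.rpow_nonneg hc _) ht, ← Real.rpow_mul hc,
            one_div_mul_cancel hr.ne', Real.rpow_one]
        simp only [map_smul, ContinuousMap.smul_apply, smul_eq_mul, abs_mul, norm_smul,
          Real.norm_eq_abs, abs_of_nonneg (Real.rpow_nonneg hc (1 / r)), e _ (abs_nonneg _),
          e _ (norm_nonneg _), ← Finset.mul_sum]
        have := mul_le_mul_of_nonneg_left (hx φ) hc
        change _ ≤ c * f φ
        linarith }
  let f : C(DualBall E, ℝ) →ₗ.[ℝ] ℝ := LinearPMap.mkSpanSingleton 1 1 one_ne_zero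
  have hf : ∀ (c : ℝ) (hc), f ⟨c • 1, hc⟩ = c := fun c hc => by
    rw [LinearPMap.mkSpanSingleton'_apply]; simp
  obtain ⟨L, hL1, hLs⟩ := riesz_extension s f
    (by
      rintro ⟨v, hv⟩ hm
      obtain ⟨c, rfl⟩ := Submodule.mem_span_singleton.1 hv
      rw [hf]
      obtain ⟨n, x, hx⟩ := hm
      -- A constant `c` in the cone bounds `∑ |φ xᵢ| ^ r` by this value of `M` for all `φ`. The
      -- summing inequality then says exactly that `c ≥ 0`.
      have := h n x (D⁻¹ * (c + ∑ i, ‖R (x i)‖ ^ r)) fun φ => by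
        have := hx φ
        simp only [ContinuousMap.smul_apply, ContinuousMap.one_apply, smul_eq_mul, mul_one] at this
        rw [inv_mul_eq_div, le_div_iff₀ hD]
        linarith
      rw [mul_inv_cancel_left₀ hD.ne'] at this
      linarith)
    (fun y => by
      refine ⟨⟨‖y‖ • 1, Submodule.smul_mem _ _ (Submodule.mem_span_singleton_self _)⟩,
        0, Fin.elim0, fun φ => ?_⟩
      have := y.norm_coe_le_norm φ
      rw [Real.norm_eq_abs] at this
      simp
      linarith [neg_abs_le (y φ)])
  obtain ⟨η, hη⟩ := exists_probabilityMeasure_of_positive L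
    (fun f hf => hLs f ⟨0, Fin.elim0, fun φ => by simpa using hf φ⟩)
    (by simpa using (hL1 ⟨(1 : ℝ) • 1, Submodule.smul_mem _ _
      (Submodule.mem_span_singleton_self _)⟩).trans (hf 1 _))
  refine ⟨η, fun x => ?_⟩
  -- The one-element family `x` puts `D |φ x| ^ r - ‖R x‖ ^ r` in the cone; integrating it against
  -- `η` gives the domination.
  have h1 := hLs (D • DualBall.evalPow hr x - (‖R x‖ ^ r) • 1)
    ⟨1, fun _ => x, fun φ => by simp [DualBall.evalPow]⟩
  have h2 : L 1 = 1 := by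
    simpa using (hL1 ⟨(1 : ℝ) • 1, Submodule.smul_mem _ _
      (Submodule.mem_span_singleton_self _)⟩).trans (hf 1 _)
  rw [map_sub, map_smul, map_smul, h2, ← hη] at h1
  simpa [DualBall.evalPow] using h1

/-! ### Hölder duality and the weak `ℓ^p` norm -/

theorem ENNReal.toReal_conjExponent_holderConjugate {p : ℝ≥0∞} (hp1 : 1 < p) (hp : p ≠ ∞) :
    p.toReal.HolderConjugate p.conjExponent.toReal := by
  lift p to ℝ≥0 using hp
  have h : 1 < p := by exact_mod_cast hp1
  rw [← ENNReal.coe_conjExponent h]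
  exact NNReal.holderConjugate_coe_iff.2 (NNReal.HolderConjugate.conjExponent h)

/-- Hölder's inequality for the unit ball of `ℓ^{p'}`. -/
theorem PiLp.sum_mul_le_of_norm_le_one {p : ℝ≥0∞} (hp1 : 1 ≤ p) (hp : p ≠ ∞) {n : ℕ}
    {a : PiLp p.conjExponent fun _ : Fin n => ℝ} (ha : ‖a‖ ≤ 1) (b : Fin n → ℝ) :
    ∑ i, a i * b i ≤ (∑ i, |b i| ^ p.toReal) ^ (1 / p.toReal) := by
  rcases hp1.eq_or_lt with rfl | h1
  · have hc : (1 : ℝ≥0∞).conjExponent = ∞ := by simp [ENNReal.conjExponent]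
    simp only [ENNReal.toReal_one, Real.rpow_one, div_one]
    refine Finset.sum_le_sum fun i _ => ?_
    have hi : |a i| ≤ 1 := by
      revert a
      rw [hc]
      intro a ha
      exact (PiLp.norm_apply_le a i).trans ha
    calc a i * b i ≤ |a i| * |b i| := by rw [← abs_mul]; exact le_abs_self _
      _ ≤ |b i| := mul_le_of_le_one_left (abs_nonneg _) hi
  · have hpq := ENNReal.toReal_conjExponent_holderConjugate h1 hp
    have h := Real.inner_le_Lp_mul_Lq Finset.univ b a hpq
    rw [PiLp.norm_eq_sum hpq.symm.pos] at ha
    simp only [mul_comm (b _)] at h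
    exact h.trans (mul_le_of_le_one_right
      (Real.rpow_nonneg (Finset.sum_nonneg fun _ _ => Real.rpow_nonneg (abs_nonneg _) _) _) ha)

/-- Hölder's inequality for the unit ball of `ℓ^{p'}` is attained. -/
theorem PiLp.exists_sum_mul_eq {p : ℝ≥0∞} (hp1 : 1 ≤ p) (hp : p ≠ ∞) {n : ℕ} (b : Fin n → ℝ) :
    ∃ a : PiLp p.conjExponent fun _ : Fin n => ℝ, ‖a‖ ≤ 1 ∧
      ∑ i, a i * b i = (∑ i, |b i| ^ p.toReal) ^ (1 / p.toReal) := by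
  rcases hp1.eq_or_lt with rfl | h1
  · have hc : (1 : ℝ≥0∞).conjExponent = ∞ := by simp [ENNReal.conjExponent]
    rw [hc]
    refine ⟨WithLp.toLp ∞ fun i => SignType.sign (b i), ?_, ?_⟩
    · rw [PiLp.norm_toLp, pi_norm_le_iff_of_nonneg zero_le_one]
      intro i
      rcases lt_trichotomy (b i) 0 with h | h | h <;> simp [h]
    · simp [sign_mul_self]
  · have hpq := ENNReal.toReal_conjExponent_holderConjugate h1 hp
    -- `g` is extremal in Hölder's inequality for `|b|`; the signs of `b` are put back afterwards.
    obtain ⟨g, hg, hgs⟩ := (NNReal.isGreatest_Lp Finset.univ (fun i => ‖b i‖₊) hpq).1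
    refine ⟨WithLp.toLp _ fun i => SignType.sign (b i) * g i, ?_, ?_⟩
    · rw [PiLp.norm_eq_sum hpq.symm.pos]
      refine Real.rpow_le_one (Finset.sum_nonneg fun _ _ => by positivity) ?_
        (by have := hpq.symm.pos; positivity)
      have hg' : ∑ i, (g i : ℝ) ^ p.conjExponent.toReal ≤ 1 := by exact_mod_cast hg
      refine le_trans (Finset.sum_le_sum fun i _ => ?_) hg'
      refine Real.rpow_le_rpow (norm_nonneg _) ?_ hpq.symm.nonneg
      rcases lt_trichotomy (b i) 0 with h | h | h <;> simp [h]
    · have := congrArg NNReal.toReal hgs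
      push_cast at this
      simp only [Real.norm_eq_abs] at this
      rw [← this]
      refine Finset.sum_congr rfl fun i _ => ?_
      simp only
      rw [mul_right_comm, sign_mul_self]

/-- The weak `ℓ^p` norm of `x`, as the norm of `a ↦ ∑ aᵢ xᵢ` on `ℓ^{p'}`. -/
def weakNorm {E : Type*} [NormedAddCommGroup E] [NormedSpace ℝ E] (p : ℝ≥0∞) {n : ℕ}
    (x : Fin n → E) : ℝ≥0∞ :=
  ⨆ (a : PiLp p.conjExponent fun _ : Fin n => ℝ) (_ : ‖a‖ ≤ 1), ‖∑ i, a i • x i‖ₑ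

section

variable {E : Type*} [NormedAddCommGroup E] [NormedSpace ℝ E] {p : ℝ≥0∞} {n : ℕ} {x : Fin n → E}

/-- A norming functional `φ` turns the norm of `∑ aᵢ xᵢ` into `∑ aᵢ φ(xᵢ)`, to which Hölder applies.
With `sum_eval_le_weakNorm` this identifies the supremum in (i) with the one over the dual ball that
defines `p`-summing operators. -/
theorem weakNorm_le_ofReal (hp1 : 1 ≤ p) (hp : p ≠ ∞) {M : ℝ}
    (hM : ∀ φ : DualBall E, ∑ i, |DualBall.eval (x i) φ| ^ p.toReal ≤ M) :
    weakNorm p x ≤ ENNReal.ofReal (M ^ (1 / p.toReal)) := by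
  refine iSup₂_le fun a ha => ?_
  obtain ⟨g, hg, hgx⟩ := exists_dual_vector'' ℝ (∑ i, a i • x i)
  let φ : DualBall E := ⟨StrongDual.toWeakDual g, hg⟩
  rw [← ofReal_norm]
  refine ENNReal.ofReal_le_ofReal ?_
  have h1 : ‖∑ i, a i • x i‖ = ∑ i, a i * DualBall.eval (x i) φ := by
    refine Eq.trans hgx.symm ?_
    rw [map_sum]
    exact Finset.sum_congr rfl fun _ _ => map_smul g _ _
  rw [h1]
  refine (PiLp.sum_mul_le_of_norm_le_one hp1 hp ha _).trans ?_
  exact Real.rpow_le_rpow (Finset.sum_nonneg fun _ _ => by positivity) (hM φ) (by positivity)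

theorem weakNorm_ne_top (hp1 : 1 ≤ p) (hp : p ≠ ∞) : weakNorm p x ≠ ∞ :=
  ((weakNorm_le_ofReal hp1 hp (M := ∑ i, ‖x i‖ ^ p.toReal) fun φ =>
    Finset.sum_le_sum fun _ _ => Real.rpow_le_rpow (abs_nonneg _) (DualBall.abs_eval_le _ φ)
      ENNReal.toReal_nonneg).trans_lt ENNReal.ofReal_lt_top).ne

/-- For fixed `φ`, the extremal `a` in Hölder's inequality for the numbers `φ(xᵢ)` gives a vector `∑
aᵢ xᵢ` on which `φ` takes the value `(∑ |φ(xᵢ)| ^ p) ^ (1 / p)`. -/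
theorem sum_eval_le_weakNorm (hp1 : 1 ≤ p) (hp : p ≠ ∞) (φ : DualBall E) :
    ∑ i, |DualBall.eval (x i) φ| ^ p.toReal ≤ (weakNorm p x).toReal ^ p.toReal := by
  have hr : 0 < p.toReal := ENNReal.toReal_pos (zero_lt_one.trans_le hp1).ne' hp
  obtain ⟨a, ha, hab⟩ := PiLp.exists_sum_mul_eq hp1 hp fun i => DualBall.eval (x i) φ
  have h0 : 0 ≤ ∑ i, |DualBall.eval (x i) φ| ^ p.toReal :=
    Finset.sum_nonneg fun _ _ => by positivity
  have h1 : ∑ i, a i * DualBall.eval (x i) φ = DualBall.eval (∑ i, a i • x i) φ := by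
    simp
  have h2 : (∑ i, |DualBall.eval (x i) φ| ^ p.toReal) ^ (1 / p.toReal) ≤ (weakNorm p x).toReal := by
    rw [← hab, h1]
    refine (le_abs_self _).trans ((DualBall.abs_eval_le _ φ).trans ?_)
    rw [← toReal_enorm]
    exact ENNReal.toReal_mono (weakNorm_ne_top hp1 hp)
      (le_iSup₂ (f := fun (a : PiLp p.conjExponent fun _ : Fin n => ℝ) (_ : ‖a‖ ≤ 1) =>
        ‖∑ i, a i • x i‖ₑ) a ha)
  have := Real.rpow_le_rpow (by positivity) h2 hr.le
  rwa [← Real.rpow_mul h0, one_div_mul_cancel hr.ne', Real.rpow_one] at this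

end

/-! ### The power of a Banach function space and its dominated functionals -/

section

variable {Ω : Type*} [MeasurableSpace Ω] {μ : Measure Ω}

theorem coeFn_absRpow (r : ℝ) (f : Ω →ₘ[μ] ℝ) : absRpow r f =ᵐ[μ] fun ω => |f ω| ^ r :=
  AEEqFun.coeFn_compMeasurable (fun t : ℝ => |t| ^ r) (by fun_prop) f

theorem MeasureTheory.AEEqFun.coeFn_sum {ι : Type*} (s : Finset ι) (f : ι → Ω →ₘ[μ] ℝ) :
    ((∑ i ∈ s, f i : Ω →ₘ[μ] ℝ) : Ω → ℝ) =ᵐ[μ] fun ω => ∑ i ∈ s, f i ω := by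
  classical
  induction s using Finset.induction_on with
  | empty => simpa using! AEEqFun.coeFn_zero (μ := μ) (β := ℝ)
  | insert a s ha ih =>
    rw [Finset.sum_insert ha]
    filter_upwards [AEEqFun.coeFn_add (f a) (∑ i ∈ s, f i), ih] with ω h1 h2
    rw [h1, Finset.sum_insert ha, Pi.add_apply, h2]

theorem coeFn_lattSum (r : ℝ) {n : ℕ} (f : Fin n → Ω →ₘ[μ] ℝ) :
    lattSum r f =ᵐ[μ] fun ω => (∑ i, |f i ω| ^ r) ^ (1 / r) := by
  have h := ae_all_iff.2 fun i => coeFn_absRpow r (f i)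
  filter_upwards [coeFn_absRpow (1 / r) (∑ i, absRpow r (f i)),
    AEEqFun.coeFn_sum Finset.univ fun i => absRpow r (f i), h] with ω h1 h2 h3
  rw [lattSum, h1, h2]
  simp only [h3]
  rw [abs_of_nonneg (Finset.sum_nonneg fun _ _ => by positivity)]

theorem absRpow_one_div_absRpow {r : ℝ} (hr : 0 < r) (f : Ω →ₘ[μ] ℝ) :
    absRpow (1 / r) (absRpow r f) =ᵐ[μ] fun ω => |f ω| := by
  filter_upwards [coeFn_absRpow (1 / r) (absRpow r f), coeFn_absRpow r f] with ω h1 h2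
  rw [h1, h2, abs_of_nonneg (by positivity), ← Real.rpow_mul (abs_nonneg _),
    mul_one_div_cancel hr.ne', Real.rpow_one]

theorem abs_absRpow_one_div_rpow {r : ℝ} (hr : 0 < r) (f : Ω →ₘ[μ] ℝ) :
    (fun ω => |absRpow (1 / r) f ω| ^ r) =ᵐ[μ] fun ω => |f ω| := by
  filter_upwards [coeFn_absRpow (1 / r) f] with ω h1
  rw [h1, abs_of_nonneg (by positivity), ← Real.rpow_mul (abs_nonneg _),
    one_div_mul_cancel hr.ne', Real.rpow_one]

namespace BanachFunctionSpace

variable (Y : BanachFunctionSpace μ)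

theorem solid_ae {f g : Ω →ₘ[μ] ℝ} (hg : g ∈ Y.carrier) (h : ∀ᵐ ω ∂μ, |f ω| ≤ |g ω|) :
    ∃ hf : f ∈ Y.carrier, ‖(⟨f, hf⟩ : Y.carrier)‖ ≤ ‖(⟨g, hg⟩ : Y.carrier)‖ :=
  Y.solid f ⟨g, hg⟩ (AEEqFun.coeFn_le.1 (by
    filter_upwards [AEEqFun.coeFn_abs f, AEEqFun.coeFn_abs g, h] with ω h1 h2 h3
    rwa [h1, h2]))

theorem norm_le_of_ae_le {f g : Y.carrier}
    (h : ∀ᵐ ω ∂μ, |(f : Ω →ₘ[μ] ℝ) ω| ≤ |(g : Ω →ₘ[μ] ℝ) ω|) : ‖f‖ ≤ ‖g‖ :=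
  (Y.solid_ae g.2 h).2

theorem extNorm_of_mem {f : Ω →ₘ[μ] ℝ} (hf : f ∈ Y.carrier) :
    Y.extNorm f = ENNReal.ofReal ‖(⟨f, hf⟩ : Y.carrier)‖ := dif_pos hf

theorem mem_of_extNorm_lt_top {f : Ω →ₘ[μ] ℝ} (hf : Y.extNorm f < ∞) : f ∈ Y.carrier := by
  by_contra h
  rw [extNorm, dif_neg h] at hf
  exact hf.false

theorem mem_of_powNorm_lt_top {r : ℝ} (hr : 0 < r) {f : Ω →ₘ[μ] ℝ} (hf : Y.powNorm r f < ∞) :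
    absRpow (1 / r) f ∈ Y.carrier :=
  Y.mem_of_extNorm_lt_top ((ENNReal.rpow_lt_top_iff_of_pos hr).1 hf)

/-- Read in the `r`-th power, `r`-convexity combined with solidity is subadditivity of the
quasi-norm up to the factor `K ^ r`. This is the consistency condition needed for Hahn–Banach. -/
theorem PConvex.norm_le {Y : BanachFunctionSpace μ} {r : ℝ} {K : ℝ} (hr : 0 < r) (hK : 0 < K)
    (h : ∀ (n : ℕ) (f : Fin n → Y.carrier),
      Y.extNorm (lattSum r fun i => (f i : Ω →ₘ[μ] ℝ)) ≤
        ENNReal.ofReal (K * (∑ i, ‖f i‖ ^ r) ^ (1 / r)))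
    (g : Y.carrier) {n : ℕ} (f : Fin n → Y.carrier)
    (hg : ∀ᵐ ω ∂μ, |(g : Ω →ₘ[μ] ℝ) ω| ^ r ≤ ∑ i, |(f i : Ω →ₘ[μ] ℝ) ω| ^ r) :
    ‖g‖ ^ r ≤ K ^ r * ∑ i, ‖f i‖ ^ r := by
  have hm := Y.mem_of_extNorm_lt_top ((h n f).trans_lt ENNReal.ofReal_lt_top)
  have hS : 0 ≤ ∑ i, ‖f i‖ ^ r := Finset.sum_nonneg fun _ _ => by positivity
  have h1 := h n f
  rw [Y.extNorm_of_mem hm, ENNReal.ofReal_le_ofReal_iff (by positivity)] at h1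
  have h2 : ‖g‖ ≤ ‖(⟨_, hm⟩ : Y.carrier)‖ := Y.norm_le_of_ae_le (by
    filter_upwards [hg, coeFn_lattSum r fun i => (f i : Ω →ₘ[μ] ℝ)] with ω h1 h2
    rw [h2, abs_of_nonneg (Real.rpow_nonneg (Finset.sum_nonneg fun _ _ => by positivity) _)]
    have := Real.rpow_le_rpow (by positivity) h1 (one_div_pos.2 hr).le
    rwa [← Real.rpow_mul (abs_nonneg _), mul_one_div_cancel hr.ne', Real.rpow_one] at this)
  have h3 := Real.rpow_le_rpow (norm_nonneg _) (h2.trans h1) hr.le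
  rwa [Real.mul_rpow hK.le (by positivity), ← Real.rpow_mul hS, one_div_mul_cancel hr.ne',
    Real.rpow_one] at h3

/-- The `r`-th power of `Y`. -/
def powSpace {r : ℝ} (hr : 1 ≤ r) : Submodule ℝ (Ω →ₘ[μ] ℝ) where
  carrier := {f | absRpow (1 / r) f ∈ Y.carrier}
  zero_mem' := by
    refine (Y.solid_ae (Y.carrier.zero_mem) ?_).1
    filter_upwards [coeFn_absRpow (1 / r) (0 : Ω →ₘ[μ] ℝ),
      AEEqFun.coeFn_zero (μ := μ) (β := ℝ)] with ω h1 h2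
    rw [h1, h2]
    simp [Real.zero_rpow (by positivity : r⁻¹ ≠ 0)]
  add_mem' := by
    intro f g hf hg
    refine (Y.solid_ae (Y.carrier.add_mem hf hg) ?_).1
    filter_upwards [coeFn_absRpow (1 / r) (f + g), coeFn_absRpow (1 / r) f,
      coeFn_absRpow (1 / r) g, AEEqFun.coeFn_add f g,
      AEEqFun.coeFn_add (absRpow (1 / r) f) (absRpow (1 / r) g)] with ω h1 h2 h3 h4 h5
    have hr0 : 0 < r := zero_lt_one.trans_le hr
    rw [h1, h5, Pi.add_apply, h2, h3, h4, Pi.add_apply,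
      abs_of_nonneg (by positivity : 0 ≤ |f ω| ^ (1 / r) + |g ω| ^ (1 / r)),
      abs_of_nonneg (by positivity : 0 ≤ |f ω + g ω| ^ (1 / r))]
    refine (Real.rpow_le_rpow (abs_nonneg _) (abs_add_le _ _) (by positivity)).trans ?_
    exact Real.rpow_add_le_add_rpow (abs_nonneg _) (abs_nonneg _) (by positivity)
      ((div_le_one hr0).2 hr)
  smul_mem' := by
    intro c f hf
    refine (Y.solid_ae (Y.carrier.smul_mem (|c| ^ (1 / r)) hf) ?_).1
    filter_upwards [coeFn_absRpow (1 / r) (c • f), coeFn_absRpow (1 / r) f,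
      AEEqFun.coeFn_smul c f,
      AEEqFun.coeFn_smul (|c| ^ (1 / r)) (absRpow (1 / r) f)] with ω h1 h2 h3 h4
    rw [h1, h4, Pi.smul_apply, h2, h3, Pi.smul_apply, smul_eq_mul, smul_eq_mul, abs_mul,
      Real.mul_rpow (abs_nonneg _) (abs_nonneg _)]

theorem absRpow_mem_powSpace {r : ℝ} (hr : 1 ≤ r) (g : Y.carrier) :
    absRpow r (g : Ω →ₘ[μ] ℝ) ∈ Y.powSpace hr :=
  Y.mem_of_powNorm_lt_top (zero_lt_one.trans_le hr)
    (Y.powNorm_absRpow_lt_top (zero_lt_one.trans_le hr) g)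

/-- On the `r`-th power of an `r`-convex space there are enough linear functionals dominated by the
quasi-norm. -/
theorem exists_dominated_functional {r : ℝ} (hr : 1 ≤ r) {K : ℝ} (hK : 0 < K)
    (h : ∀ (n : ℕ) (f : Fin n → Y.carrier),
      Y.extNorm (lattSum r fun i => (f i : Ω →ₘ[μ] ℝ)) ≤
        ENNReal.ofReal (K * (∑ i, ‖f i‖ ^ r) ^ (1 / r)))
    (g₀ : Y.carrier) :
    ∃ L : Y.powSpace hr →ₗ[ℝ] ℝ,
      (∀ (v : Y.powSpace hr) (g : Y.carrier),
        (∀ᵐ ω ∂μ, (v : Ω →ₘ[μ] ℝ) ω ≤ |(g : Ω →ₘ[μ] ℝ) ω| ^ r) → L v ≤ ‖g‖ ^ r) ∧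
      ‖g₀‖ ^ r ≤ K ^ r * L ⟨_, Y.absRpow_mem_powSpace hr g₀⟩ := by
  have hr0 : 0 < r := zero_lt_one.trans_le hr
  have hKr : 0 < K ^ r := by positivity
  have hpow : ∀ c : ℝ, 0 ≤ c → ∀ t : ℝ, 0 ≤ t → (c ^ (1 / r) * t) ^ r = c * t ^ r :=
    fun c hc t ht => by
      rw [Real.mul_rpow (by positivity) ht, ← Real.rpow_mul hc, one_div_mul_cancel hr0.ne',
        Real.rpow_one]
  have hsm : ∀ (c : ℝ) (g : Y.carrier), 0 ≤ c → ∀ᵐ ω ∂μ,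
      |((c ^ (1 / r) • g : Y.carrier) : Ω →ₘ[μ] ℝ) ω| ^ r = c * |(g : Ω →ₘ[μ] ℝ) ω| ^ r := by
    intro c g hc
    filter_upwards [AEEqFun.coeFn_smul (c ^ (1 / r)) (g : Ω →ₘ[μ] ℝ)] with ω h1
    rw [Submodule.coe_smul, h1, Pi.smul_apply, smul_eq_mul, abs_mul,
      abs_of_nonneg (by positivity : 0 ≤ c ^ (1 / r)), hpow c hc _ (abs_nonneg _)]
  have hsn : ∀ (c : ℝ) (g : Y.carrier), 0 ≤ c → ‖c ^ (1 / r) • g‖ ^ r = c * ‖g‖ ^ r := by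
    intro c g hc
    rw [norm_smul, Real.norm_eq_abs, abs_of_nonneg (by positivity : 0 ≤ c ^ (1 / r)),
      hpow c hc _ (norm_nonneg _)]
  -- The cone encodes all the wanted bounds `L v ≤ c` together. Taking `t = 0` and one `g` gives
  -- domination by the quasi-norm; taking `t = 1` and no `g` gives `L (-|g₀| ^ r) ≤ -K ^ (-r) ‖g₀‖ ^
  -- r`, the lower bound at `g₀`.
  let s : PointedCone ℝ (Y.powSpace hr × ℝ) :=
    { carrier := {a | ∃ (t : ℝ) (n : ℕ) (g : Fin n → Y.carrier), 0 ≤ t ∧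
        (∀ᵐ ω ∂μ, (a.1 : Ω →ₘ[μ] ℝ) ω + t * |(g₀ : Ω →ₘ[μ] ℝ) ω| ^ r ≤
          ∑ i, |(g i : Ω →ₘ[μ] ℝ) ω| ^ r) ∧
        K ^ r * ∑ i, ‖g i‖ ^ r - t * ‖g₀‖ ^ r ≤ K ^ r * a.2}
      zero_mem' := by
        refine ⟨0, 0, Fin.elim0, le_rfl, ?_, by simp⟩
        filter_upwards [AEEqFun.coeFn_zero (μ := μ) (β := ℝ)] with ω h1
        simp [h1]
      add_mem' := by
        rintro ⟨a, c⟩ ⟨a', c'⟩ ⟨t, n, g, ht, h1, h2⟩ ⟨t', n', g', ht', h1', h2'⟩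
        refine ⟨t + t', n + n', Fin.append g g', add_nonneg ht ht', ?_, ?_⟩
        · filter_upwards [h1, h1', AEEqFun.coeFn_add (a : Ω →ₘ[μ] ℝ) (a' : Ω →ₘ[μ] ℝ)]
            with ω e1 e2 e3
          simp only [Prod.mk_add_mk, Submodule.coe_add, Fin.sum_univ_add, Fin.append_left,
            Fin.append_right, e3, Pi.add_apply] at *
          linarith
        · simp only [Prod.mk_add_mk, Fin.sum_univ_add, Fin.append_left, Fin.append_right] at *
          linarith
      smul_mem' := by
        rintro ⟨b, hb⟩ ⟨a, c⟩ ⟨t, n, g, ht, h1, h2⟩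
        refine ⟨b * t, n, fun i => b ^ (1 / r) • g i, mul_nonneg hb ht, ?_, ?_⟩
        · filter_upwards [h1, AEEqFun.coeFn_smul b (a : Ω →ₘ[μ] ℝ),
            ae_all_iff.2 fun i => hsm b (g i) hb] with ω e1 e2 e3
          change (b • (a : Ω →ₘ[μ] ℝ) : Ω →ₘ[μ] ℝ) ω + _ ≤ _
          rw [e2, Finset.sum_congr rfl fun i _ => e3 i, ← Finset.mul_sum]
          have := mul_le_mul_of_nonneg_left e1 hb
          simp only [Pi.smul_apply, smul_eq_mul]
          linarith
        · change _ ≤ K ^ r * (b * c)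
          simp only [hsn b _ hb, ← Finset.mul_sum]
          have := mul_le_mul_of_nonneg_left h2 hb
          simp only at this
          linarith }
  obtain ⟨L, hL⟩ := exists_linearMap_le_of_cone s
    (by
      rintro c ⟨t, n, g, ht, h1, h2⟩
      -- A bound at `v = 0` comes from `t |g₀| ^ r ≤ ∑ |gᵢ| ^ r`, and convexity for `t ^ (1 / r) •
      -- g₀` makes `c` nonnegative.
      have h3 := PConvex.norm_le hr0 hK h (t ^ (1 / r) • g₀) g (by
        filter_upwards [h1, hsm t g₀ ht, AEEqFun.coeFn_zero (μ := μ) (β := ℝ)] with ω e1 e2 e3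
        rw [e2]
        simpa [e3] using e1)
      rw [hsn t _ ht] at h3
      simp only at h2
      exact nonneg_of_mul_nonneg_right (by linarith) hKr)
    (fun v => ⟨‖(⟨_, v.2⟩ : Y.carrier)‖ ^ r, 0, 1, fun _ => ⟨_, v.2⟩, le_rfl, by
      filter_upwards [abs_absRpow_one_div_rpow hr0 (v : Ω →ₘ[μ] ℝ)] with ω e1
      simp [-one_div, e1, le_abs_self], by simp⟩)
  refine ⟨L, fun v g hv => hL v _ ⟨0, 1, fun _ => g, le_rfl, by simpa using hv, by simp⟩, ?_⟩
  have h1 := hL (-⟨_, Y.absRpow_mem_powSpace hr g₀⟩) (-(K ^ r)⁻¹ * ‖g₀‖ ^ r)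
    ⟨1, 0, Fin.elim0, zero_le_one, by
      filter_upwards [AEEqFun.coeFn_neg (absRpow r (g₀ : Ω →ₘ[μ] ℝ)),
        coeFn_absRpow r (g₀ : Ω →ₘ[μ] ℝ)] with ω e1 e2
      simp [e1, e2], by
      refine le_of_eq ?_
      field_simp
      simp⟩
  rw [map_neg] at h1
  have h2 := mul_le_mul_of_nonneg_left (neg_le_neg h1) hKr.le
  rw [neg_neg] at h2
  refine le_trans (le_of_eq ?_) h2
  field_simp

end BanachFunctionSpace

end

/-! ### Dominated functionals are densities in the Köthe dual -/

namespace BanachFunctionSpace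

variable {Ω : Type*} [MeasurableSpace Ω] {μ : Measure Ω} (Y : BanachFunctionSpace μ)
  {r : ℝ} (hr : 1 ≤ r)

/-- A simple function, as an element of the `r`-th power of `Y`. -/
def simplePow : SimpleFunc Ω ℝ →ₗ[ℝ] Y.powSpace hr where
  toFun s := ⟨AEEqFun.mk s s.aestronglyMeasurable,
    (Y.simple_mem (s.map fun t => |t| ^ (1 / r)) :)⟩
  map_add' _ _ := rfl
  map_smul' _ _ := rfl

theorem coeFn_simplePow (s : SimpleFunc Ω ℝ) :
    ((Y.simplePow hr s : Ω →ₘ[μ] ℝ) : Ω → ℝ) =ᵐ[μ] s :=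
  AEEqFun.coeFn_mk _ _

section

variable {Y hr} {L : Y.powSpace hr →ₗ[ℝ] ℝ}
  (hL : ∀ (v : Y.powSpace hr) (g : Y.carrier),
    (∀ᵐ ω ∂μ, (v : Ω →ₘ[μ] ℝ) ω ≤ |(g : Ω →ₘ[μ] ℝ) ω| ^ r) → L v ≤ ‖g‖ ^ r)

include hL

/-- Since `-v ≤ 0 = |0| ^ r`, domination with `g = 0` gives `L (-v) ≤ 0`. -/
theorem functional_nonneg {v : Y.powSpace hr} (hv : ∀ᵐ ω ∂μ, 0 ≤ (v : Ω →ₘ[μ] ℝ) ω) : 0 ≤ L v := by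
  have hr0 : 0 < r := zero_lt_one.trans_le hr
  have h := hL (-v) 0 (by
    filter_upwards [hv, AEEqFun.coeFn_neg (v : Ω →ₘ[μ] ℝ)] with ω h1 h2
    rw [Submodule.coe_neg, h2, Pi.neg_apply]
    exact (neg_nonpos.2 h1).trans (by positivity))
  rw [map_neg, norm_zero, Real.zero_rpow hr0.ne'] at h
  linarith

/-- The functions `w n = (u n) ^ (1 / r)` decrease to `0` in `Y`, so order continuity applies to
them, and `0 ≤ L (u n) ≤ ‖w n‖ ^ r`. -/
theorem functional_tendsto_zero (hoc : Y.OrderContinuous) {u : ℕ → Y.powSpace hr}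
    (hanti : ∀ᵐ ω ∂μ, Antitone fun n => (u n : Ω →ₘ[μ] ℝ) ω)
    (hlim : ∀ᵐ ω ∂μ, Tendsto (fun n => (u n : Ω →ₘ[μ] ℝ) ω) atTop (𝓝 0)) :
    Tendsto (fun n => L (u n)) atTop (𝓝 0) := by
  have hr0 : 0 < r := zero_lt_one.trans_le hr
  have hpos : ∀ᵐ ω ∂μ, ∀ n, 0 ≤ (u n : Ω →ₘ[μ] ℝ) ω := by
    filter_upwards [hanti, hlim] with ω h1 h2 n using h1.le_of_tendsto h2 n
  let w : ℕ → Y.carrier := fun n => ⟨_, (u n).2⟩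
  have hw : ∀ᵐ ω ∂μ, ∀ n, (w n : Ω →ₘ[μ] ℝ) ω = |(u n : Ω →ₘ[μ] ℝ) ω| ^ (1 / r) :=
    ae_all_iff.2 fun n => coeFn_absRpow (1 / r) (u n : Ω →ₘ[μ] ℝ)
  have h1 : Tendsto (fun n => ‖w n‖) atTop (𝓝 0) := by
    refine hoc w (fun m n hmn => AEEqFun.coeFn_le.1 ?_) ?_
    · filter_upwards [hanti, hpos, hw] with ω e1 e2 e3
      rw [e3, e3, abs_of_nonneg (e2 _), abs_of_nonneg (e2 _)]
      exact Real.rpow_le_rpow (e2 _) (e1 hmn) (by positivity)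
    · filter_upwards [hlim, hw] with ω e1 e3
      simp only [e3]
      have := e1.abs.rpow_const (p := 1 / r) (Or.inr (by positivity))
      rwa [abs_zero, Real.zero_rpow (by positivity)] at this
  have h2 : Tendsto (fun n => ‖w n‖ ^ r) atTop (𝓝 0) := by
    have := h1.rpow_const (p := r) (Or.inr hr0.le)
    rwa [Real.zero_rpow hr0.ne'] at this
  refine squeeze_zero (fun n => functional_nonneg hL (ae_all_iff.1 hpos n)) (fun n => ?_) h2
  refine hL _ _ ?_
  filter_upwards [abs_absRpow_one_div_rpow hr0 (u n : Ω →ₘ[μ] ℝ)] with ω e1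
  exact (le_abs_self _).trans e1.ge

/-- The indicator function of a measurable set, as a simple function. -/
def _root_.MeasureTheory.SimpleFunc.ind (A : Set Ω) : SimpleFunc Ω ℝ :=
  (SimpleFunc.const Ω 1).restrict A

omit hL in
theorem _root_.MeasureTheory.SimpleFunc.ind_apply {A : Set Ω} (hA : MeasurableSet A) (ω : Ω) :
    SimpleFunc.ind A ω = A.indicator 1 ω := by
  rw [SimpleFunc.ind, SimpleFunc.restrict_apply _ hA]
  rfl

/-- A dominated functional defines a signed measure. -/
def functionalMeasure (hoc : Y.OrderContinuous) : SignedMeasure Ω where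
  measureOf' A := L (Y.simplePow hr (SimpleFunc.ind A))
  empty' := by simp [SimpleFunc.ind]
  not_measurable' A hA := by
    rw [SimpleFunc.ind, SimpleFunc.restrict_of_not_measurable hA, map_zero, map_zero]
  m_iUnion' := by
    intro A hA hd
    -- The tails decrease to the empty set, and by additivity `L` of the indicator of `B n` is the
    -- remainder of the series.
    let B : ℕ → Set Ω := fun n => ⋃ i ≥ n, A i
    have hB : ∀ n, MeasurableSet (B n) := fun n =>
      MeasurableSet.iUnion fun i => MeasurableSet.iUnion fun _ => hA i
    have hBs : ∀ n, B n = A n ∪ B (n + 1) := fun n => by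
      ext ω
      simp only [B, Set.mem_iUnion, Set.mem_union, exists_prop]
      constructor
      · rintro ⟨i, hi, h⟩
        rcases hi.eq_or_lt with rfl | hi
        · exact Or.inl h
        · exact Or.inr ⟨i, hi, h⟩
      · rintro (h | ⟨i, hi, h⟩)
        · exact ⟨n, le_rfl, h⟩
        · exact ⟨i, by omega, h⟩
    have hdis : ∀ n, Disjoint (A n) (B (n + 1)) := fun n => by
      simp only [B, Set.disjoint_iUnion_right]
      exact fun i hi => hd (by omega)
    have hadd : ∀ n, SimpleFunc.ind (B n) = SimpleFunc.ind (A n) + SimpleFunc.ind (B (n + 1)) := by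
      intro n
      ext ω
      rw [SimpleFunc.add_apply, SimpleFunc.ind_apply (hB _), SimpleFunc.ind_apply (hB _),
        SimpleFunc.ind_apply (hA _), hBs n, Set.indicator_union_of_disjoint (hdis n)]
    have hsum : ∀ n, ∑ i ∈ Finset.range n, L (Y.simplePow hr (SimpleFunc.ind (A i))) =
        L (Y.simplePow hr (SimpleFunc.ind (⋃ i, A i))) -
          L (Y.simplePow hr (SimpleFunc.ind (B n))) := by
      intro n
      induction n with
      | zero =>
        have : B 0 = ⋃ i, A i := by simp [B]
        simp [this]
      | succ n ih =>
        rw [Finset.sum_range_succ, ih, hadd n, map_add, map_add]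
        ring
    have hcoe : ∀ᵐ ω ∂μ, ∀ n, (Y.simplePow hr (SimpleFunc.ind (B n)) : Ω →ₘ[μ] ℝ) ω =
        (B n).indicator 1 ω := ae_all_iff.2 fun n => by
      filter_upwards [Y.coeFn_simplePow hr (SimpleFunc.ind (B n))] with ω h
      rw [h, SimpleFunc.ind_apply (hB n)]
    have hlim := functional_tendsto_zero hL hoc
      (u := fun n => Y.simplePow hr (SimpleFunc.ind (B n)))
      (by
        filter_upwards [hcoe] with ω h
        simp only [h]
        intro m n hmn
        refine Set.indicator_le_indicator_of_subset ?_ (fun _ => zero_le_one) ω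
        exact Set.iUnion_mono fun i => Set.iUnion_mono' fun hi => ⟨hmn.trans hi, le_rfl⟩)
      (by
        filter_upwards [hcoe] with ω h
        simp only [h]
        refine tendsto_const_nhds.congr' ?_
        by_cases hω : ∃ k, ω ∈ A k
        · obtain ⟨k, hk⟩ := hω
          filter_upwards [eventually_gt_atTop k] with n hn
          rw [Set.indicator_of_notMem]
          simp only [B, Set.mem_iUnion, not_exists]
          exact fun i hi hAi => (hd (by omega : k ≠ i)).le_bot ⟨hk, hAi⟩
        · filter_upwards with n
          rw [Set.indicator_of_notMem]
          simp only [B, Set.mem_iUnion, not_exists]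
          exact fun i _ hAi => hω ⟨i, hAi⟩)
    refine (hasSum_iff_tendsto_nat_of_nonneg (fun i => functional_nonneg hL ?_) _).2 ?_
    · filter_upwards [Y.coeFn_simplePow hr (SimpleFunc.ind (A i))] with ω h
      rw [h, SimpleFunc.ind_apply (hA i)]
      exact Set.indicator_nonneg (fun _ _ => zero_le_one) _
    · simp only [hsum]
      simpa using hlim.const_sub (L (Y.simplePow hr (SimpleFunc.ind (⋃ i, A i))))

/-- A dominated functional is represented by a density on the simple functions. -/
theorem exists_density_simple [IsFiniteMeasure μ] (hoc : Y.OrderContinuous) :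
    ∃ y : Ω → ℝ, Integrable y μ ∧ 0 ≤ᵐ[μ] y ∧
      ∀ s : SimpleFunc Ω ℝ, Integrable (fun ω => s ω * y ω) μ ∧
        L (Y.simplePow hr s) = ∫ ω, s ω * y ω ∂μ := by
  let ν := functionalMeasure hL hoc
  have hν : ∀ A, ν A = L (Y.simplePow hr (SimpleFunc.ind A)) := fun _ => rfl
  -- The indicator of a null set is the zero class, so `L` vanishes on it.
  have hac : ν ≪ᵥ μ.toENNRealVectorMeasure := by
    refine VectorMeasure.AbsolutelyContinuous.mk fun A hA h => ?_
    rw [Measure.toENNRealVectorMeasure_apply_measurable hA] at h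
    have : Y.simplePow hr (SimpleFunc.ind A) = 0 := by
      refine Subtype.ext (AEEqFun.ext ?_)
      filter_upwards [Y.coeFn_simplePow hr (SimpleFunc.ind A), measure_eq_zero_iff_ae_notMem.1 h,
        AEEqFun.coeFn_zero (μ := μ) (β := ℝ)] with ω h1 h2 h3
      rw [h1, SimpleFunc.ind_apply hA, Set.indicator_of_notMem h2, Submodule.coe_zero, h3]
      rfl
    rw [hν, this, map_zero]
  have hi := SignedMeasure.integrable_rnDeriv ν μ
  have hd : ∀ A, MeasurableSet A → ∫ ω in A, ν.rnDeriv μ ω ∂μ = ν A := fun A hA => by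
    rw [← withDensityᵥ_apply hi hA, SignedMeasure.withDensityᵥ_rnDeriv_eq ν μ hac]
  refine ⟨ν.rnDeriv μ, hi, ?_, fun s => ?_⟩
  · refine ae_nonneg_of_forall_setIntegral_nonneg hi fun A hA _ => ?_
    rw [hd A hA, hν]
    refine functional_nonneg hL ?_
    filter_upwards [Y.coeFn_simplePow hr (SimpleFunc.ind A)] with ω h
    rw [h, SimpleFunc.ind_apply hA]
    exact Set.indicator_nonneg (fun _ _ => zero_le_one) _
  · induction s using SimpleFunc.induction with
    | @const c A hA =>
      have h1 : SimpleFunc.piecewise A hA (SimpleFunc.const Ω c) (SimpleFunc.const Ω 0) =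
          c • SimpleFunc.ind A := by
        ext ω
        by_cases hω : ω ∈ A <;> simp [SimpleFunc.ind_apply hA, hω]
      have h2 : (fun ω => (c • SimpleFunc.ind A) ω * ν.rnDeriv μ ω) =
          fun ω => c * A.indicator (ν.rnDeriv μ) ω := by
        ext ω
        by_cases hω : ω ∈ A <;> simp [SimpleFunc.ind_apply hA, hω]
      rw [h1, h2]
      refine ⟨(hi.indicator hA).const_mul c, ?_⟩
      rw [integral_const_mul, integral_indicator hA, hd A hA, map_smul, map_smul, hν, smul_eq_mul]
    | @add f g _ hf hg =>
      have h1 : (fun ω => (f + g) ω * ν.rnDeriv μ ω) =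
          fun ω => f ω * ν.rnDeriv μ ω + g ω * ν.rnDeriv μ ω := by
        ext ω
        simp [add_mul]
      rw [h1]
      refine ⟨hf.1.add hg.1, ?_⟩
      rw [integral_add hf.1 hg.1, map_add, map_add, hf.2, hg.2]

/-- A dominated functional is represented by a density on nonnegative elements. -/
theorem exists_density_nonneg [IsFiniteMeasure μ] (hoc : Y.OrderContinuous) :
    ∃ y : Ω → ℝ, Integrable y μ ∧ 0 ≤ᵐ[μ] y ∧
      ∀ v : Y.powSpace hr, (∀ᵐ ω ∂μ, 0 ≤ (v : Ω →ₘ[μ] ℝ) ω) →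
        Integrable (fun ω => (v : Ω →ₘ[μ] ℝ) ω * y ω) μ ∧
          L v = ∫ ω, (v : Ω →ₘ[μ] ℝ) ω * y ω ∂μ := by
  obtain ⟨y, hyi, hy0, hys⟩ := exists_density_simple hL hoc
  refine ⟨y, hyi, hy0, fun v hv => ?_⟩
  have hvm : Measurable fun ω => ENNReal.ofReal ((v : Ω →ₘ[μ] ℝ) ω) :=
    (AEEqFun.stronglyMeasurable _).measurable.ennreal_ofReal
  let s : ℕ → SimpleFunc Ω ℝ := fun n =>
    (SimpleFunc.eapprox (fun ω => ENNReal.ofReal ((v : Ω →ₘ[μ] ℝ) ω)) n).map ENNReal.toReal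
  have hs0 : ∀ n ω, 0 ≤ s n ω := fun n ω => ENNReal.toReal_nonneg
  have hsm : ∀ ω, Monotone fun n => s n ω := fun ω m n hmn =>
    ENNReal.toReal_mono (SimpleFunc.eapprox_lt_top _ _ _).ne (SimpleFunc.monotone_eapprox _ hmn ω)
  have hst : ∀ᵐ ω ∂μ, Tendsto (fun n => s n ω) atTop (𝓝 ((v : Ω →ₘ[μ] ℝ) ω)) := by
    filter_upwards [hv] with ω h
    have := (ENNReal.tendsto_toReal ENNReal.ofReal_ne_top).comp (SimpleFunc.tendsto_eapprox hvm ω)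
    rwa [ENNReal.toReal_ofReal h] at this
  have hcoe : ∀ᵐ ω ∂μ, ∀ n, ((v - Y.simplePow hr (s n) : Y.powSpace hr) : Ω →ₘ[μ] ℝ) ω =
      (v : Ω →ₘ[μ] ℝ) ω - s n ω := ae_all_iff.2 fun n => by
    filter_upwards [Y.coeFn_simplePow hr (s n),
      AEEqFun.coeFn_sub (v : Ω →ₘ[μ] ℝ) (Y.simplePow hr (s n) : Ω →ₘ[μ] ℝ)] with ω h1 h2
    rw [Submodule.coe_sub, h2, Pi.sub_apply, h1]
  -- Both sides pass to the limit along simple functions increasing to `v`: the functional because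
  -- `v - s n` decreases to `0`, the integral by monotone convergence. Finiteness of `L v` then
  -- yields integrability.
  have hlim := functional_tendsto_zero hL hoc (u := fun n => v - Y.simplePow hr (s n))
    (by
      filter_upwards [hcoe] with ω h m n hmn
      simp only [h]
      exact sub_le_sub_left (hsm ω hmn) _)
    (by
      filter_upwards [hcoe, hst] with ω h h2
      simp only [h]
      simpa using h2.const_sub ((v : Ω →ₘ[μ] ℝ) ω))
  have hlim2 : Tendsto (fun n => ∫ ω, s n ω * y ω ∂μ) atTop (𝓝 (L v)) := by
    have := hlim.const_sub (L v)
    simp only [map_sub, sub_sub_cancel, sub_zero] at this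
    simpa only [(hys _).2] using this
  have hlim3 : Tendsto (fun n => ∫⁻ ω, ENNReal.ofReal (s n ω * y ω) ∂μ) atTop
      (𝓝 (∫⁻ ω, ENNReal.ofReal ((v : Ω →ₘ[μ] ℝ) ω * y ω) ∂μ)) := by
    refine lintegral_tendsto_of_tendsto_of_monotone
      (fun n => (hys _).1.aestronglyMeasurable.aemeasurable.ennreal_ofReal) ?_ ?_
    · filter_upwards [hy0] with ω h m n hmn
      exact ENNReal.ofReal_le_ofReal (mul_le_mul_of_nonneg_right (hsm ω hmn) h)
    · filter_upwards [hst] with ω h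
      exact ENNReal.tendsto_ofReal (h.mul_const _)
  have heq : ∀ n, ∫⁻ ω, ENNReal.ofReal (s n ω * y ω) ∂μ =
      ENNReal.ofReal (∫ ω, s n ω * y ω ∂μ) := fun n => by
    rw [ofReal_integral_eq_lintegral_ofReal (hys _).1]
    filter_upwards [hy0] with ω h
    exact mul_nonneg (hs0 n ω) h
  simp only [heq] at hlim3
  have hint := tendsto_nhds_unique hlim3 (ENNReal.tendsto_ofReal hlim2)
  have hnn : 0 ≤ᵐ[μ] fun ω => (v : Ω →ₘ[μ] ℝ) ω * y ω := by
    filter_upwards [hy0, hv] with ω h1 h2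
    exact mul_nonneg h2 h1
  have hmeas : AEStronglyMeasurable (fun ω => (v : Ω →ₘ[μ] ℝ) ω * y ω) μ :=
    (AEEqFun.aestronglyMeasurable _).mul hyi.aestronglyMeasurable
  refine ⟨⟨hmeas, ?_⟩, ?_⟩
  · rw [hasFiniteIntegral_iff_ofReal hnn, hint]
    exact ENNReal.ofReal_lt_top
  · rw [integral_eq_lintegral_of_nonneg_ae hnn hmeas, hint,
      ENNReal.toReal_ofReal (functional_nonneg hL hv)]

end

/-- The positive part of the unit ball of the Köthe dual of the `r`-th power is norming. -/
theorem exists_mem_posBall_norming [IsFiniteMeasure μ] {r : ℝ} (hr : 1 ≤ r)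
    (hoc : Y.OrderContinuous) {K : ℝ} (hK : 0 < K)
    (h : ∀ (n : ℕ) (f : Fin n → Y.carrier),
      Y.extNorm (lattSum r fun i => (f i : Ω →ₘ[μ] ℝ)) ≤
        ENNReal.ofReal (K * (∑ i, ‖f i‖ ^ r) ^ (1 / r)))
    (g : Y.carrier) :
    ∃ y ∈ Y.posBall r, ‖g‖ ^ r ≤ K ^ r * ∫ ω, |(g : Ω →ₘ[μ] ℝ) ω| ^ r * y ω ∂μ := by
  have hr0 : 0 < r := zero_lt_one.trans_le hr
  obtain ⟨L, hL, hLg⟩ := Y.exists_dominated_functional hr hK h g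
  obtain ⟨y, hyi, hy0, hy⟩ := exists_density_nonneg hL hoc
  let z : Ω →ₘ[μ] ℝ := AEEqFun.mk y hyi.aestronglyMeasurable
  have hz : z =ᵐ[μ] y := AEEqFun.coeFn_mk _ _
  -- Passing to `|f|` extends the representation to signed functions. The integrability gives
  -- membership in the Köthe dual, the inequality gives norm at most `1`.
  have habs : ∀ f : Ω →ₘ[μ] ℝ, (hf : absRpow (1 / r) f ∈ Y.carrier) →
      Integrable (fun ω => |f ω| * y ω) μ ∧
        ∫ ω, |f ω| * y ω ∂μ ≤ ‖(⟨_, hf⟩ : Y.carrier)‖ ^ r := by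
    intro f hf
    have hm : |f| ∈ Y.powSpace hr := by
      refine (Y.solid_ae hf ?_).1
      filter_upwards [coeFn_absRpow (1 / r) f, coeFn_absRpow (1 / r) |f|,
        AEEqFun.coeFn_abs f] with ω h1 h2 h3
      rw [h1, h2, h3, abs_abs]
    have hcoe : (fun ω => |f| ω * y ω) =ᵐ[μ] fun ω => |f ω| * y ω := by
      filter_upwards [AEEqFun.coeFn_abs f] with ω h3
      rw [h3]
    obtain ⟨h1, h2⟩ := hy ⟨_, hm⟩ (by
      filter_upwards [AEEqFun.coeFn_abs f] with ω h3
      rw [h3]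
      exact abs_nonneg _)
    refine ⟨h1.congr hcoe, ?_⟩
    rw [← integral_congr_ae hcoe, ← h2]
    refine hL _ _ ?_
    filter_upwards [AEEqFun.coeFn_abs f, abs_absRpow_one_div_rpow hr0 f] with ω h3 h4
    rw [h3]
    exact h4.ge
  have hint : ∀ f : Ω →ₘ[μ] ℝ, absRpow (1 / r) f ∈ Y.carrier →
      Integrable (fun ω => f ω * z ω) μ := fun f hf => by
    refine (habs f hf).1.mono
      ((AEEqFun.aestronglyMeasurable _).mul (AEEqFun.aestronglyMeasurable _)) ?_
    filter_upwards [hz] with ω h1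
    simp [h1]
  refine ⟨z, ⟨fun f hf => hint f (Y.mem_of_powNorm_lt_top hr0 hf), ?_, ?_⟩, ?_⟩
  · refine iSup₂_le fun f hf => ?_
    have hfm := Y.mem_of_powNorm_lt_top hr0 (hf.trans_lt ENNReal.one_lt_top)
    rw [← ENNReal.ofReal_one]
    refine ENNReal.ofReal_le_ofReal ?_
    have h1 : ∫ ω, f ω * z ω ∂μ ≤ ∫ ω, |f ω| * y ω ∂μ := by
      refine integral_mono_ae (hint f hfm) (habs f hfm).1 ?_
      filter_upwards [hz, hy0] with ω e1 e2
      simp only [e1]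
      exact mul_le_mul_of_nonneg_right (le_abs_self _) e2
    refine h1.trans ((habs f hfm).2.trans ?_)
    rw [powNorm, Y.extNorm_of_mem hfm, ENNReal.ofReal_rpow_of_nonneg (norm_nonneg _) hr0.le,
      ENNReal.ofReal_le_one] at hf
    exact hf
  · rw [← AEEqFun.coeFn_le]
    filter_upwards [hz, hy0, AEEqFun.coeFn_zero (μ := μ) (β := ℝ)] with ω e1 e2 e3
    rw [e1, e3]
    exact e2
  · refine hLg.trans_eq ?_
    rw [(hy _ (by
      filter_upwards [coeFn_absRpow r (g : Ω →ₘ[μ] ℝ)] with ω e1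
      rw [e1]
      positivity)).2]
    congr 1
    refine integral_congr_ae ?_
    filter_upwards [hz, coeFn_absRpow r (g : Ω →ₘ[μ] ℝ)] with ω e1 e2
    rw [e1, e2]

end BanachFunctionSpace

/-! ### Lattice summability as uniform `p`-summability of `i ∘ T` -/

namespace BanachFunctionSpace

variable {Ω : Type*} [MeasurableSpace Ω] {μ : Measure Ω} (Y : BanachFunctionSpace μ)

theorem integrable_rpow_mul {r : ℝ} (hr : 0 < r) {y : Ω →ₘ[μ] ℝ} (hy : y ∈ Y.powKothe r)
    (h : Y.carrier) : Integrable (fun ω => |(h : Ω →ₘ[μ] ℝ) ω| ^ r * y ω) μ := by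
  refine (hy _ (Y.powNorm_absRpow_lt_top hr h)).congr ?_
  filter_upwards [coeFn_absRpow r (h : Ω →ₘ[μ] ℝ)] with ω h1
  rw [h1]

/-- The Köthe norm tests only functions of quasi-norm at most `1`, so `h ≠ 0` is divided by its norm
and both sides are scaled back by `‖h‖ ^ r`. -/
theorem integral_rpow_mul_le {r : ℝ} (hr : 0 < r) {y : Ω →ₘ[μ] ℝ} (hy : y ∈ Y.posBall r)
    (h : Y.carrier) : ∫ ω, |(h : Ω →ₘ[μ] ℝ) ω| ^ r * y ω ∂μ ≤ ‖h‖ ^ r := by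
  rcases eq_or_ne h 0 with rfl | h0
  · rw [norm_zero, Real.zero_rpow hr.ne']
    refine (integral_eq_zero_of_ae ?_).le
    filter_upwards [AEEqFun.coeFn_zero (μ := μ) (β := ℝ)] with ω h1
    simp [h1, Real.zero_rpow hr.ne']
  have hn : 0 < ‖h‖ := norm_pos_iff.2 h0
  let g : Y.carrier := ‖h‖⁻¹ • h
  have hg : ‖g‖ = 1 := by
    rw [norm_smul, norm_inv, norm_norm, inv_mul_cancel₀ hn.ne']
  have hgm : absRpow (1 / r) (absRpow r (g : Ω →ₘ[μ] ℝ)) ∈ Y.carrier :=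
    Y.mem_of_powNorm_lt_top hr (Y.powNorm_absRpow_lt_top hr g)
  have hgn : Y.powNorm r (absRpow r (g : Ω →ₘ[μ] ℝ)) ≤ 1 := by
    rw [powNorm, Y.extNorm_of_mem hgm]
    refine ENNReal.rpow_le_one (ENNReal.ofReal_le_one.2 ?_) hr.le
    refine (Y.norm_le_of_ae_le (g := g) ?_).trans_eq hg
    filter_upwards [absRpow_one_div_absRpow hr (g : Ω →ₘ[μ] ℝ)] with ω h1
    rw [h1, abs_abs]
  have h1 := (le_iSup₂ (f := fun (f : Ω →ₘ[μ] ℝ) (_ : Y.powNorm r f ≤ 1) =>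
    ENNReal.ofReal (∫ ω, f ω * y ω ∂μ)) _ hgn).trans hy.2.1
  rw [ENNReal.ofReal_le_one] at h1
  have h2 : ∫ ω, |(h : Ω →ₘ[μ] ℝ) ω| ^ r * y ω ∂μ =
      ‖h‖ ^ r * ∫ ω, absRpow r (g : Ω →ₘ[μ] ℝ) ω * y ω ∂μ := by
    rw [← integral_const_mul]
    refine integral_congr_ae ?_
    filter_upwards [coeFn_absRpow r (g : Ω →ₘ[μ] ℝ),
      AEEqFun.coeFn_smul (‖h‖⁻¹) (h : Ω →ₘ[μ] ℝ)] with ω e1 e2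
    rw [e1, Submodule.coe_smul, e2, Pi.smul_apply, smul_eq_mul, abs_mul,
      Real.mul_rpow (abs_nonneg _) (abs_nonneg _), abs_inv, abs_norm,
      Real.inv_rpow hn.le]
    have : ‖h‖ ^ r ≠ 0 := by positivity
    field_simp
  rw [h2]
  exact mul_le_of_le_one_right (by positivity) h1

theorem norm_inclusion_rpow {p : ℝ≥0∞} [hp1 : Fact (1 ≤ p)] (hp : p ≠ ∞) {y : Ω →ₘ[μ] ℝ}
    (hy : y ∈ Y.posBall p.toReal) (f : Y.carrier) :
    ‖Y.inclusion hp hy.1 f‖ ^ p.toReal =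
      ∫ ω, |(f : Ω →ₘ[μ] ℝ) ω| ^ p.toReal * y ω ∂μ := by
  have hp0 : p ≠ 0 := (lt_of_lt_of_le one_pos hp1.out).ne'
  have hr : 0 < p.toReal := ENNReal.toReal_pos hp0 hp
  have hy0 : ∀ᵐ ω ∂μ, 0 ≤ y ω := by
    filter_upwards [AEEqFun.coeFn_le.2 hy.2.2, AEEqFun.coeFn_zero (μ := μ) (β := ℝ)] with ω h1 h2
    rw [h2] at h1
    exact h1
  have h1 : ‖Y.inclusion hp hy.1 f‖ =
      (∫ ω, ‖(f : Ω →ₘ[μ] ℝ) ω‖ ^ p.toReal ∂(weighted μ y)) ^ p.toReal⁻¹ := by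
    change ‖(Y.memLp_weighted hp hy.1 f).toLp _‖ = _
    rw [Lp.norm_toLp, MemLp.eLpNorm_eq_integral_rpow_norm hp0 hp (Y.memLp_weighted hp hy.1 f),
      ENNReal.toReal_ofReal (Real.rpow_nonneg (integral_nonneg fun _ => by positivity) _)]
  rw [h1, ← Real.rpow_mul (integral_nonneg fun _ => by positivity), inv_mul_cancel₀ hr.ne',
    Real.rpow_one, weighted, integral_withDensity_eq_integral_toReal_smul₀
      (AEEqFun.aestronglyMeasurable y).aemeasurable.ennreal_ofReal
      (ae_of_all _ fun _ => ENNReal.ofReal_lt_top)]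
  refine integral_congr_ae ?_
  filter_upwards [hy0] with ω h
  rw [ENNReal.toReal_ofReal h, smul_eq_mul, Real.norm_eq_abs, mul_comm]

variable {E : Type*} [NormedAddCommGroup E] [NormedSpace ℝ E]

/-- Pointwise, the `p`-th power of the lattice sum is `∑ |fᵢ| ^ p`. This identity is the bridge
between norms in `Y` and `p`-summing inequalities in `L^p(y dμ)`. -/
theorem sum_norm_inclusion_rpow {p : ℝ≥0∞} [hp1 : Fact (1 ≤ p)] (hp : p ≠ ∞) {y : Ω →ₘ[μ] ℝ}
    (hy : y ∈ Y.posBall p.toReal) {n : ℕ} (f : Fin n → Y.carrier) (g : Y.carrier)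
    (hg : (g : Ω →ₘ[μ] ℝ) = lattSum p.toReal fun i => (f i : Ω →ₘ[μ] ℝ)) :
    ∑ i, ‖Y.inclusion hp hy.1 (f i)‖ ^ p.toReal =
      ∫ ω, |(g : Ω →ₘ[μ] ℝ) ω| ^ p.toReal * y ω ∂μ := by
  have hr : 0 < p.toReal := ENNReal.toReal_pos (lt_of_lt_of_le one_pos hp1.out).ne' hp
  simp only [Y.norm_inclusion_rpow hp hy]
  rw [← integral_finsetSum _ fun i _ => Y.integrable_rpow_mul hr hy.1 (f i)]
  refine integral_congr_ae ?_
  filter_upwards [coeFn_lattSum p.toReal fun i => (f i : Ω →ₘ[μ] ℝ)] with ω h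
  have h0 : 0 ≤ ∑ i, |(f i : Ω →ₘ[μ] ℝ) ω| ^ p.toReal := Finset.sum_nonneg fun _ _ => by positivity
  rw [hg, h, abs_of_nonneg (Real.rpow_nonneg h0 _), ← Real.rpow_mul h0,
    one_div_mul_cancel hr.ne', Real.rpow_one, Finset.sum_mul]

/-- All the operators `i ∘ T`, for `y` in the positive part of the unit ball of the Köthe dual, are
`p`-summing, with a common bound. -/
def UniformlySumming {p : ℝ≥0∞} [Fact (1 ≤ p)] (hp : p ≠ ∞) (T : E →L[ℝ] Y.carrier)
    (D : ℝ) : Prop :=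
  ∀ (y : Ω →ₘ[μ] ℝ) (hy : y ∈ Y.posBall p.toReal) (n : ℕ) (x : Fin n → E) (M : ℝ),
    (∀ φ : DualBall E, ∑ i, |DualBall.eval (x i) φ| ^ p.toReal ≤ M) →
      ∑ i, ‖Y.inclusion hp hy.1 (T (x i))‖ ^ p.toReal ≤ D * M

variable {Y} {p : ℝ≥0∞} [hp1 : Fact (1 ≤ p)] (hp : p ≠ ∞) {T : E →L[ℝ] Y.carrier}

-- The integral of the `p`-th power of the lattice sum against `y` is at most the `p`-th power of
-- its norm, so `D = C ^ p` serves every `y`.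
include hp in
theorem IsLatticeSumming.exists_uniformlySumming (h : Y.IsLatticeSumming p T) :
    ∃ D : ℝ, 0 < D ∧ Y.UniformlySumming hp T D := by
  have hr : 0 < p.toReal := ENNReal.toReal_pos (lt_of_lt_of_le one_pos hp1.out).ne' hp
  obtain ⟨C, hC, h⟩ := h
  have hC' : (0 : ℝ) < C := hC
  refine ⟨(C : ℝ) ^ p.toReal, by positivity, fun y hy n x M hM => ?_⟩
  have hM0 : 0 ≤ M :=
    (Finset.sum_nonneg fun _ _ => by positivity).trans (hM (Classical.arbitrary _))
  have h1 : Y.extNorm (lattSum p.toReal fun i => (T (x i) : Ω →ₘ[μ] ℝ)) ≤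
      ENNReal.ofReal (C * M ^ (1 / p.toReal)) := by
    rw [ENNReal.ofReal_mul C.coe_nonneg, ENNReal.ofReal_coe_nnreal]
    exact (h n x).trans (mul_le_mul_right (weakNorm_le_ofReal hp1.out hp hM) _)
  have hm := Y.mem_of_extNorm_lt_top (h1.trans_lt ENNReal.ofReal_lt_top)
  rw [Y.extNorm_of_mem hm, ENNReal.ofReal_le_ofReal_iff (by positivity)] at h1
  rw [Y.sum_norm_inclusion_rpow hp hy (fun i => T (x i)) ⟨_, hm⟩ rfl]
  refine (Y.integral_rpow_mul_le hr hy _).trans ?_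
  have h2 := Real.rpow_le_rpow (norm_nonneg _) h1 hr.le
  rwa [Real.mul_rpow C.coe_nonneg (by positivity), ← Real.rpow_mul hM0,
    one_div_mul_cancel hr.ne', Real.rpow_one] at h2

/-- The density `y` that norms the lattice sum depends on the family `x`, which is harmless because
`D` is the same for all `y`. The constant is `K D ^ (1 / p)`, with `K` the convexity constant. -/
theorem UniformlySumming.isLatticeSumming [IsFiniteMeasure μ] (hconv : Y.PConvex p.toReal)
    (hoc : Y.OrderContinuous) {D : ℝ} (hD : 0 < D) (h : Y.UniformlySumming hp T D) :
    Y.IsLatticeSumming p T := by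
  have hr : 0 < p.toReal := ENNReal.toReal_pos (lt_of_lt_of_le one_pos hp1.out).ne' hp
  have hr1 : 1 ≤ p.toReal := by
    rw [← ENNReal.toReal_one]
    exact ENNReal.toReal_mono hp hp1.out
  obtain ⟨K, hK, hconv⟩ := hconv
  have hC : 0 < K * D ^ (1 / p.toReal) := by positivity
  refine ⟨⟨_, hC.le⟩, hC, fun n x => ?_⟩
  change _ ≤ _ * weakNorm p x
  have hm := Y.mem_of_extNorm_lt_top
    ((hconv n fun i => T (x i)).trans_lt ENNReal.ofReal_lt_top)
  obtain ⟨y, hy, hyg⟩ := Y.exists_mem_posBall_norming hr1 hoc hK hconv ⟨_, hm⟩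
  rw [← Y.sum_norm_inclusion_rpow hp hy (fun i => T (x i)) ⟨_, hm⟩ rfl] at hyg
  have h1 := h y hy n x _ fun φ => sum_eval_le_weakNorm hp1.out hp φ
  have h2 := hyg.trans (mul_le_mul_of_nonneg_left h1 (by positivity))
  set W := (weakNorm p x).toReal with hW
  have hW0 : 0 ≤ W := ENNReal.toReal_nonneg
  have h3 : K ^ p.toReal * (D * W ^ p.toReal) = (K * D ^ (1 / p.toReal) * W) ^ p.toReal := by
    rw [Real.mul_rpow hC.le hW0, Real.mul_rpow hK.le (by positivity), ← Real.rpow_mul hD.le,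
      one_div_mul_cancel hr.ne', Real.rpow_one, mul_assoc]
  rw [h3, Real.rpow_le_rpow_iff (norm_nonneg _) (by positivity) hr] at h2
  rw [Y.extNorm_of_mem hm, ← ENNReal.ofReal_toReal (weakNorm_ne_top (x := x) hp1.out hp), ← hW]
  refine (ENNReal.ofReal_le_ofReal h2).trans_eq ?_
  rw [ENNReal.ofReal_mul hC.le, ENNReal.ofReal, Real.toNNReal_of_nonneg hC.le]
  rfl

end BanachFunctionSpace

/-! ### The `p`-summing norm, the easy half of Pietsch's theorem, and factorization -/

section

variable {E F : Type*} [NormedAddCommGroup E] [NormedSpace ℝ E] [NormedAddCommGroup F]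
  [NormedSpace ℝ F]

theorem enorm_sum_rpow {G : Type*} [NormedAddCommGroup G] {r : ℝ} (hr : 0 < r) {n : ℕ}
    (z : Fin n → G) :
    (∑ i, ‖z i‖ₑ ^ r) ^ (1 / r) = ENNReal.ofReal ((∑ i, ‖z i‖ ^ r) ^ (1 / r)) := by
  rw [← ENNReal.ofReal_rpow_of_nonneg (Finset.sum_nonneg fun _ _ => by positivity) (by positivity),
    ENNReal.ofReal_sum_of_nonneg fun _ _ => by positivity]
  simp only [← ENNReal.ofReal_rpow_of_nonneg (norm_nonneg _) hr.le, ofReal_norm]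

theorem pSummingNorm_le {r : ℝ} (hr : 0 < r) (R : E →ₗ[ℝ] F) (C : ℝ≥0)
    (h : ∀ (n : ℕ) (x : Fin n → E) (M : ℝ),
      (∀ φ : DualBall E, ∑ i, |DualBall.eval (x i) φ| ^ r ≤ M) →
        ∑ i, ‖R (x i)‖ ^ r ≤ (C : ℝ) ^ r * M) :
    pSummingNorm r R ≤ C := by
  refine iInf₂_le C fun n x => ?_
  simp only [enorm_sum_rpow hr]
  set S : ℝ≥0∞ := ⨆ φ : DualBall E,
    ENNReal.ofReal ((∑ i, ‖DualBall.eval (x i) φ‖ ^ r) ^ (1 / r)) with hS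
  -- Each `|φ(xᵢ)|` is at most `‖xᵢ‖`, so the supremum is finite and its `r`-th power can be used as
  -- the real bound `M`.
  have hS1 : S ≠ ∞ := by
    refine ((iSup_le fun φ => ENNReal.ofReal_le_ofReal (Real.rpow_le_rpow
      (Finset.sum_nonneg fun _ _ => by positivity) (Finset.sum_le_sum fun i _ =>
        Real.rpow_le_rpow (norm_nonneg _) (DualBall.abs_eval_le (x i) φ) hr.le)
      (by positivity))).trans_lt ENNReal.ofReal_lt_top).ne
  have h1 := h n x (S.toReal ^ r) fun φ => by
    have h2 : (∑ i, |DualBall.eval (x i) φ| ^ r) ^ (1 / r) ≤ S.toReal := by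
      rw [← ENNReal.ofReal_le_iff_le_toReal hS1]
      exact le_iSup (fun φ : DualBall E =>
        ENNReal.ofReal ((∑ i, ‖DualBall.eval (x i) φ‖ ^ r) ^ (1 / r))) φ
    have h0 : 0 ≤ ∑ i, |DualBall.eval (x i) φ| ^ r := Finset.sum_nonneg fun _ _ => by positivity
    have := Real.rpow_le_rpow (by positivity) h2 hr.le
    rwa [← Real.rpow_mul h0, one_div_mul_cancel hr.ne', Real.rpow_one] at this
  rw [← Real.mul_rpow C.coe_nonneg ENNReal.toReal_nonneg] at h1
  have h2 := Real.rpow_le_rpow (Finset.sum_nonneg fun _ _ => by positivity) h1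
    (one_div_pos.2 hr).le
  rw [← Real.rpow_mul (by positivity), mul_one_div_cancel hr.ne', Real.rpow_one] at h2
  refine (ENNReal.ofReal_le_ofReal h2).trans_eq ?_
  rw [ENNReal.ofReal_mul C.coe_nonneg, ENNReal.ofReal_coe_nnreal, ENNReal.ofReal_toReal hS1]

/-- The strict inequality supplies an admissible constant below `C`, so it does not matter whether
the infimum is attained. -/
theorem sum_le_of_pSummingNorm_lt {r : ℝ} (hr : 0 < r) {R : E →ₗ[ℝ] F} {C : ℝ≥0}
    (h : pSummingNorm r R < C) {n : ℕ} {x : Fin n → E} {M : ℝ}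
    (hM : ∀ φ : DualBall E, ∑ i, |DualBall.eval (x i) φ| ^ r ≤ M) :
    ∑ i, ‖R (x i)‖ ^ r ≤ (C : ℝ) ^ r * M := by
  obtain ⟨K, hK⟩ := iInf_lt_iff.1 h
  obtain ⟨hR, hKC⟩ := iInf_lt_iff.1 hK
  have hM0 : 0 ≤ M :=
    (Finset.sum_nonneg fun _ _ => by positivity).trans (hM (Classical.arbitrary _))
  have h0 : 0 ≤ ∑ i, ‖R (x i)‖ ^ r := Finset.sum_nonneg fun _ _ => by positivity
  have h1 := hR n x
  simp only [enorm_sum_rpow hr] at h1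
  have h2 : ENNReal.ofReal ((∑ i, ‖R (x i)‖ ^ r) ^ (1 / r)) ≤
      ENNReal.ofReal (C * M ^ (1 / r)) := by
    rw [ENNReal.ofReal_mul C.coe_nonneg, ENNReal.ofReal_coe_nnreal]
    refine h1.trans (mul_le_mul' hKC.le (iSup_le fun φ => ENNReal.ofReal_le_ofReal ?_))
    exact Real.rpow_le_rpow (Finset.sum_nonneg fun _ _ => by positivity) (hM φ) (by positivity)
  rw [ENNReal.ofReal_le_ofReal_iff (by positivity)] at h2
  have h3 := Real.rpow_le_rpow (by positivity) h2 hr.le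
  rwa [← Real.rpow_mul h0, Real.mul_rpow C.coe_nonneg (by positivity), ← Real.rpow_mul hM0,
    one_div_mul_cancel hr.ne', Real.rpow_one, Real.rpow_one] at h3

/-- The easy half of Pietsch's theorem: sum the dominations and integrate the pointwise bound `M`
against a probability measure. -/
theorem sum_le_of_domination {G : Type*} [NormedAddCommGroup G] {r : ℝ} (hr : 0 < r)
    {R : E → G} {D : ℝ} (hD : 0 ≤ D) (η : ProbabilityMeasure (DualBall E))
    (h : ∀ x, ‖R x‖ ^ r ≤ D * ∫ φ, |DualBall.eval x φ| ^ r ∂(η : Measure (DualBall E)))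
    {n : ℕ} {x : Fin n → E} {M : ℝ}
    (hM : ∀ φ : DualBall E, ∑ i, |DualBall.eval (x i) φ| ^ r ≤ M) :
    ∑ i, ‖R (x i)‖ ^ r ≤ D * M := by
  have hi : ∀ x : E, Integrable (fun φ => |DualBall.eval x φ| ^ r) (η : Measure (DualBall E)) :=
    fun x => (DualBall.evalPow hr x).continuous.integrable_of_hasCompactSupport
      (HasCompactSupport.of_compactSpace _)
  refine (Finset.sum_le_sum fun i _ => h (x i)).trans ?_
  rw [← Finset.mul_sum, ← integral_finsetSum _ fun i _ => hi (x i)]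
  refine mul_le_mul_of_nonneg_left ?_ hD
  refine (integral_mono (integrable_finsetSum _ fun i _ => hi (x i))
    (integrable_const M) hM).trans ?_
  simp

theorem norm_toLp_eval {p : ℝ≥0∞} [hp1 : Fact (1 ≤ p)] (hp : p ≠ ∞)
    (η : ProbabilityMeasure (DualBall E)) (x : E) :
    ‖ContinuousMap.toLp p (η : Measure (DualBall E)) ℝ (DualBall.eval x)‖ =
      (∫ φ, |DualBall.eval x φ| ^ p.toReal ∂(η : Measure (DualBall E))) ^ (1 / p.toReal) := by
  have hp0 : p ≠ 0 := (lt_of_lt_of_le one_pos hp1.out).ne'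
  have hc := ContinuousMap.coeFn_toLp (p := p) (𝕜 := ℝ) (η : Measure (DualBall E)) (DualBall.eval x)
  rw [Lp.norm_def, MemLp.eLpNorm_eq_integral_rpow_norm hp0 hp (Lp.memLp _),
    ENNReal.toReal_ofReal (Real.rpow_nonneg (integral_nonneg fun _ => by positivity) _), one_div]
  congr 1
  refine integral_congr_ae ?_
  filter_upwards [hc] with φ h
  rw [h, Real.norm_eq_abs]

/-- The domination shows that `R` vanishes on the kernel of `J : E → L^p(η)`, so `R` descends to the
range of `J`, with norm at most `C`. That range is the subspace `S`; it need not be closed. -/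
theorem factorsThroughSubspace_of_domination {p : ℝ≥0∞} [Fact (1 ≤ p)]
    {R : E →ₗ[ℝ] F} {η : ProbabilityMeasure (DualBall E)} {C : ℝ}
    (h : ∀ x, ‖R x‖ ≤
      C * ‖ContinuousMap.toLp p (η : Measure (DualBall E)) ℝ (DualBall.eval x)‖) :
    FactorsThroughSubspace p R η := by
  let J : E →ₗ[ℝ] Lp ℝ p (η : Measure (DualBall E)) :=
    (ContinuousMap.toLp p (η : Measure (DualBall E)) ℝ).toLinearMap ∘ₗ DualBall.eval
  have hJ : ∀ x, ‖R x‖ ≤ C * ‖J x‖ := h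
  have hker : LinearMap.ker J ≤ LinearMap.ker R := fun x hx => by
    have := hJ x
    rw [LinearMap.mem_ker.1 hx, norm_zero, mul_zero] at this
    exact norm_le_zero_iff.1 this
  let T₀ : LinearMap.range J →ₗ[ℝ] F :=
    (LinearMap.ker J).liftQ R hker ∘ₗ J.quotKerEquivRange.symm.toLinearMap
  have hT₀ : ∀ (x : E) (hx : J x ∈ LinearMap.range J), T₀ ⟨J x, hx⟩ = R x := fun x hx => by
    have : J.quotKerEquivRange.symm ⟨J x, hx⟩ = (LinearMap.ker J).mkQ x := by
      rw [LinearEquiv.symm_apply_eq]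
      rfl
    simp only [T₀, LinearMap.comp_apply, LinearEquiv.coe_coe, this]
    rfl
  refine ⟨LinearMap.range J, fun x => ⟨x, rfl⟩, T₀.mkContinuous C ?_, fun x => hT₀ x _⟩
  rintro ⟨_, x, rfl⟩
  exact (congrArg norm (hT₀ x _)).le.trans (hJ x)

end

end

/-! ### The equivalence of the three conditions -/

theorem mainTheorem9 {Ω : Type*} [MeasurableSpace Ω] (μ : Measure Ω) [IsFiniteMeasure μ]
    {E : Type*} [NormedAddCommGroup E] [NormedSpace ℝ E] [CompleteSpace E]
    (p : ℝ≥0∞) [Fact (1 ≤ p)] (hp : p ≠ ∞)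
    (Y : BanachFunctionSpace μ) (hconv : Y.PConvex p.toReal) (hoc : Y.OrderContinuous)
    (T : E →L[ℝ] Y.carrier) :
    [ Y.IsLatticeSumming p T,
      ∃ C : ℝ, 0 < C ∧ ∀ y ∈ Y.posBall p.toReal, ∃ η : ProbabilityMeasure (DualBall E), ∀ x : E,
        (∫ ω, |(T x : Ω →ₘ[μ] ℝ) ω| ^ p.toReal * y ω ∂μ) ^ (1 / p.toReal) ≤
          C * (∫ φ, |DualBall.eval x φ| ^ p.toReal ∂(η : Measure (DualBall E))) ^ (1 / p.toReal),
      ∃ C : ℝ≥0, ∀ (y : Ω →ₘ[μ] ℝ) (hy : y ∈ Y.posBall p.toReal),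
        (∃ η : ProbabilityMeasure (DualBall E),
          FactorsThroughSubspace p (Y.inclusion hp hy.1 ∘ₗ T.toLinearMap) η) ∧
        pSummingNorm p.toReal (Y.inclusion hp hy.1 ∘ₗ T.toLinearMap) ≤ C ].TFAE := by
  have hr : 0 < p.toReal := ENNReal.toReal_pos (lt_of_lt_of_le one_pos Fact.out).ne' hp
  have hpow : ∀ t : ℝ, 0 ≤ t → (t ^ (1 / p.toReal)) ^ p.toReal = t := fun t ht => by
    rw [← Real.rpow_mul ht, one_div_mul_cancel hr.ne', Real.rpow_one]
  have hroot : ∀ t : ℝ, 0 ≤ t → (t ^ p.toReal) ^ (1 / p.toReal) = t := fun t ht => by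
    rw [← Real.rpow_mul ht, mul_one_div_cancel hr.ne', Real.rpow_one]
  have hpietsch : ∀ D : ℝ, 0 < D → Y.UniformlySumming hp T D →
      ∃ C : ℝ, 0 < C ∧ ∀ y ∈ Y.posBall p.toReal, ∃ η : ProbabilityMeasure (DualBall E), ∀ x : E,
        (∫ ω, |(T x : Ω →ₘ[μ] ℝ) ω| ^ p.toReal * y ω ∂μ) ^ (1 / p.toReal) ≤
          C * (∫ φ, |DualBall.eval x φ| ^ p.toReal ∂(η : Measure (DualBall E))) ^
            (1 / p.toReal) := by
    intro D hD h
    refine ⟨D ^ (1 / p.toReal), by positivity, fun y hy => ?_⟩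
    obtain ⟨η, hη⟩ := exists_pietsch_measure hr (Y.inclusion hp hy.1 ∘ₗ T.toLinearMap)
      (h y hy) hD
    refine ⟨η, fun x => ?_⟩
    have hi : 0 ≤ ∫ φ, |DualBall.eval x φ| ^ p.toReal ∂(η : Measure (DualBall E)) :=
      integral_nonneg fun _ => by positivity
    rw [← Y.norm_inclusion_rpow hp hy, ← Real.mul_rpow hD.le hi]
    exact Real.rpow_le_rpow (by positivity) (hη x) (by positivity)
  have hdom : ∀ (y : Ω →ₘ[μ] ℝ) (hy : y ∈ Y.posBall p.toReal) (η : ProbabilityMeasure (DualBall E))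
      (C : ℝ), 0 < C → (∀ x : E,
        (∫ ω, |(T x : Ω →ₘ[μ] ℝ) ω| ^ p.toReal * y ω ∂μ) ^ (1 / p.toReal) ≤
          C * (∫ φ, |DualBall.eval x φ| ^ p.toReal ∂(η : Measure (DualBall E))) ^
            (1 / p.toReal)) → ∀ x, ‖Y.inclusion hp hy.1 (T x)‖ ^ p.toReal ≤
        C ^ p.toReal * ∫ φ, |DualBall.eval x φ| ^ p.toReal ∂(η : Measure (DualBall E)) := by
    intro y hy η C hC h x
    have hi : 0 ≤ ∫ φ, |DualBall.eval x φ| ^ p.toReal ∂(η : Measure (DualBall E)) :=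
      integral_nonneg fun _ => by positivity
    have h1 := h x
    rw [← Y.norm_inclusion_rpow hp hy, hroot _ (norm_nonneg _)] at h1
    have h2 := Real.rpow_le_rpow (norm_nonneg _) h1 hr.le
    rwa [Real.mul_rpow hC.le (by positivity), hpow _ hi] at h2
  tfae_have 1 → 2 := fun h => by
    obtain ⟨D, hD, h⟩ := h.exists_uniformlySumming hp
    exact hpietsch D hD h
  tfae_have 2 → 1 := fun ⟨C, hC, h⟩ => by
    refine BanachFunctionSpace.UniformlySumming.isLatticeSumming hp hconv hoc
      (D := C ^ p.toReal) (by positivity) fun y hy n x M hM => ?_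
    obtain ⟨η, hη⟩ := h y hy
    exact sum_le_of_domination (R := fun x => Y.inclusion hp hy.1 (T x)) hr (by positivity) η
      (hdom y hy η C hC hη) hM
  tfae_have 2 → 3 := fun ⟨C, hC, h⟩ => by
    refine ⟨⟨C, hC.le⟩, fun y hy => ?_⟩
    obtain ⟨η, hη⟩ := h y hy
    refine ⟨⟨η, factorsThroughSubspace_of_domination (C := C) fun x => ?_⟩,
      pSummingNorm_le hr _ _ fun n x M hM => sum_le_of_domination
        (R := fun x => Y.inclusion hp hy.1 (T x)) hr (by positivity) η (hdom y hy η C hC hη) hM⟩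
    have h1 := hη x
    rw [← Y.norm_inclusion_rpow hp hy, hroot _ (norm_nonneg _)] at h1
    rw [norm_toLp_eval hp]
    exact h1
  tfae_have 3 → 2 := fun ⟨C, h⟩ => by
    -- Enlarging `C` to `C + 1` makes the bound on the summing norm strict and the constant
    -- positive, even if `C = 0`.
    refine hpietsch (((C + 1 : ℝ≥0) : ℝ) ^ p.toReal) (by positivity) fun y hy n x M hM => ?_
    refine sum_le_of_pSummingNorm_lt (R := Y.inclusion hp hy.1 ∘ₗ T.toLinearMap) hr
      ((h y hy).2.trans_lt ?_) hM
    exact_mod_cast lt_add_one C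
  tfae_finish
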